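/- Let $(R,\mathfrak m)$ be a Noetherian local ring with total ring of fractions $Q$, and let $E$ be a finitely generated $R$-module having rank $e\ge 2$, i.e. $E\otimes_R Q\cong Q^e$. Let $U=\sum_{i=1}^k Ra_i$ be a reduction of $E$, that is, $\mathcal R(E)_{r+1}=U\cdot\mathcal R(E)_r$ for some $r\ge 0$, where $\mathcal R(E)$ is the symmetric algebra of $E$ modulo its $R$-torsion. Let $\mathbf Z=\{z_{ij}\mid 1\le i\le k,\ 1\le j\le e-1\}$ be indeterminates, and put $$R''=R[\mathbf Z]_{\mathfrak m R[\mathbf Z]},\quad E''=E\otimes_R R'',\quad x_j=\sum_{i=1}^k z_{ij}a_i,\quad F=\sum_{j=1}^{e-1}R''x_j\subseteq E''.$$ An ideal $I$ of $R''$ is called a generic Bourbaki ideal of $E$ with respect to $U$ if $x_1,\dots,x_{e-1}$ is a basis of $F$, $E''/F$ is torsion-free of rank $1$, and $I\cong E''/F$. Write $I_t(A)$ for the ideal generated by the $t\times t$ minors of a matrix $A$ (with $I_0(A)=R''$), $F_e(E)$ for the $e$-th Fitting ideal of $E$, and let the unit ideal have grade $\infty$. Extend $x_1,\dots,x_{e-1}$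 to generators $x_1,\dots,x_n$ of $E''$, let $\varphi$ be an $n\times m$ matrix presenting $E''$ with respect to $x_1,\dots,x_n$ (so that $R''^m\xrightarrow{\varphi}R''^n\to E''\to0$ is exact), and let $\psi$ be an $(n-e+1)\times(n-e)$ submatrix of $\varphi$, formed by the rows $e,\dots,n$ and some $n-e$ columns, with $\operatorname{grade} I_{n-e}(\psi)\ge 1$. For $e\le i\le n$ let $\Delta_i=(-1)^{i-e}|\psi_i|$, where $\psi_i$ is $\psi$ without the row that comes from row $i$ of $\varphi$, and let $\theta\colon R''^{\,n-e+1}\to R''$ be the linear map whose values on the canonical basis are $\Delta_e,\dots,\Delta_n$. Then: 1. The maps $\psi$ and $\theta$ form a complex $$0\to R''^{\,n-e}\xrightarrow{\ \psi\ }R''^{\,n-e+1}\xrightarrow{\ \theta\ }I_{n-e}(\psi)\to 0$$ in which $\psi$ is injective and $\theta$ maps onto $I_{n-e}(\psi)$. 2. Suppose in addition that $E$ is torsion-free and $\operatorname{grade}F_e(E)\ge 2$. Then $E$ has a generic Bourbaki ideal $I\cong E''/F$ in $R''$, and every such ideal $I$ is isomorphic, as an $R''$-module, to $I_{n-e}(\psi)$.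 3. Suppose moreover, besides the hypotheses of 2, that $E$ is not free and $\operatorname{grade}I_{n-e}(\psi)\ge 2$. Then $I=I_{n-e}(\psi)$ is a generic Bourbaki ideal of $E$ with respect to $U$, it is perfect of grade $2$ (that is, $\operatorname{grade} I=2=\operatorname{proj\,dim}_{R''}R''/I$), the complex in 1 is exact and hence a free resolution of $I$, and there is an isomorphism $E''/F\cong I$ that sends $\overline{x_i}=x_i+F$ to $\Delta_i$ for $e\le i\le n$ and under which $\psi$ presents $I$ with respect to the generators $\overline{x_e},\dots,\overline{x_n}$. -/

import Mathlib

open scoped TensorProduct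

namespace BourbakiFitting

noncomputable section

/-! ### Rank, grade, perfection -/

/-- The base change `Q ⊗ M` is free of rank `e` over the `R`-algebra `Q`. -/
def IsFreeOfRankOver (R : Type*) [CommRing R] (M : Type*) [AddCommGroup M] [Module R M]
    (Q : Type*) [CommRing Q] [Algebra R Q] (e : ℕ) : Prop :=
  Nonempty ((Q ⊗[R] M) ≃ₗ[Q] (Fin e → Q))

/-- `M` has rank `e`: `Q ⊗ M ≅ Q ^ e`, where `Q` is the total ring of fractions of `R`
(`FractionRing R` is the localization of `R` at its non-zero-divisors). -/
def HasRank (R : Type*) [CommRing R] (M : Type*) [AddCommGroup M] [Module R M] (e : ℕ) : Prop :=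
  IsFreeOfRankOver R M (FractionRing R) e

/-- The grade of an ideal `I` of a (Noetherian) ring: the supremum of the lengths of the weakly
`R`-regular sequences contained in `I`. If `I ≠ ⊤`, such a sequence is automatically regular;
if `I = ⊤` the grade is `⊤`, by the sequences `1, 1, …, 1`. -/
def grade {R : Type*} [CommRing R] (I : Ideal R) : ℕ∞ :=
  ⨆ (rs : List R) (_ : RingTheory.Sequence.IsWeaklyRegular R rs) (_ : ∀ r ∈ rs, r ∈ I),
    (rs.length : ℕ∞)

/-- The ideal `I` is perfect of grade `g`: `grade I = g = proj dim (R / I)`. -/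
def IsPerfectOfGrade {R : Type*} [CommRing R] (I : Ideal R) (g : ℕ) : Prop :=
  grade I = (g : ℕ∞) ∧
    CategoryTheory.projectiveDimension (ModuleCat.of R (R ⧸ I)) = ((g : ℕ∞) : WithBot ℕ∞)

/-! ### Determinantal ideals, presentations, Fitting ideals -/

/-- `I_t(A)`, the ideal generated by the `t × t` minors of the matrix `A`.
(Repeated row or column indices only contribute the value `0`, and a different order of the
indices only changes the sign. The empty minor is `1`, so `I_0(A)` is the unit ideal.) -/
def minorIdeal {R : Type*} [CommRing R] {p q : Type*} (t : ℕ) (A : Matrix p q R) : Ideal R :=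
  Ideal.span (Set.range fun rc : (Fin t → p) × (Fin t → q) => (A.submatrix rc.1 rc.2).det)

/-- The matrix `A` presents `M` with respect to the elements `x_i`: the `x_i` generate `M`, and
the columns of `A` generate their module of relations, i.e. `R^q → R^p → M → 0` is exact. -/
def IsPresentation {R : Type*} [CommRing R] {M : Type*} [AddCommGroup M] [Module R M]
    {p q : Type*} [Fintype p] [Fintype q] (A : Matrix p q R) (x : p → M) : Prop :=
  Submodule.span R (Set.range x) = ⊤ ∧
    LinearMap.range A.mulVecLin = LinearMap.ker (Fintype.linearCombination R x)

/-- The Fitting ideal `F_i(M) = I_{n-i}(A)`, for a finite presentation `R^m → R^n → M → 0` with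
matrix `A`. The ideal does not depend on the presentation; here we take the sum over all finite
presentations. If `n ≤ i` then `n - i` is `0` and the ideal is the unit ideal. -/
def fittingIdeal (R : Type*) [CommRing R] (M : Type*) [AddCommGroup M] [Module R M] (i : ℕ) :
    Ideal R :=
  ⨆ (n : ℕ) (m : ℕ) (A : Matrix (Fin n) (Fin m) R) (x : Fin n → M) (_ : IsPresentation A x),
    minorIdeal (n - i) A

/-- The `i`-th signed maximal minor `(-1)^i |ψ_i|` of a `(d+1) × d` matrix `ψ`, where `ψ_i` is
obtained from `ψ` by deleting the `i`-th row (rows are numbered from `0`). -/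
def signedMinor {R : Type*} [CommRing R] {d : ℕ} (ψ : Matrix (Fin (d + 1)) (Fin d) R)
    (i : Fin (d + 1)) : R :=
  (-1) ^ (i : ℕ) * (ψ.submatrix i.succAbove id).det

/-- The map `R^{d+1} → R` given by the signed maximal minors of `ψ`; it is
`v ↦ v ∧ u_1 ∧ ⋯ ∧ u_d`, with `u_j` the columns of `ψ`, under `⋀^{d+1} R^{d+1} = R`. -/
def minorMap {R : Type*} [CommRing R] {d : ℕ} (ψ : Matrix (Fin (d + 1)) (Fin d) R) :
    (Fin (d + 1) → R) →ₗ[R] R :=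
  Fintype.linearCombination R (signedMinor ψ)

/-! ### Rees algebra and reductions of modules -/

/-- The `R`-torsion of an `R`-algebra `A` (the elements killed by a non-zero-divisor of `R`),
as an ideal of `A`. -/
def torsionIdeal (R : Type*) [CommRing R] (A : Type*) [CommRing A] [Algebra R A] : Ideal A where
  carrier := Submodule.torsion R A
  add_mem' := fun ha hb => add_mem ha hb
  zero_mem' := zero_mem _
  smul_mem' := by
    intro c x hx
    obtain ⟨r, hr⟩ := (Submodule.mem_torsion_iff x).1 hx
    refine (Submodule.mem_torsion_iff _).2 ⟨r, ?_⟩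
    have h : (r : R) • x = 0 := hr
    change (r : R) • (c * x) = 0
    rw [← mul_smul_comm, h, mul_zero]

/-- The Rees algebra of a module: the symmetric algebra modulo its `R`-torsion. -/
abbrev ReesAlgebra (R : Type*) [CommRing R] (E : Type*) [AddCommGroup E] [Module R E] : Type _ :=
  SymmetricAlgebra R E ⧸ torsionIdeal R (SymmetricAlgebra R E)

/-- The canonical map from `E` to (the degree one part of) its Rees algebra. -/
def toRees (R : Type*) [CommRing R] (E : Type*) [AddCommGroup E] [Module R E] :
    E →ₗ[R] ReesAlgebra R E :=
  (Ideal.Quotient.mkₐ R (torsionIdeal R (SymmetricAlgebra R E))).toLinearMap ∘ₗ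
    SymmetricAlgebra.ι R E

/-- The graded piece of degree `r` of the Rees algebra, namely the `r`-th power of the image
of `E`. -/
def reesPiece (R : Type*) [CommRing R] (E : Type*) [AddCommGroup E] [Module R E] (r : ℕ) :
    Submodule R (ReesAlgebra R E) :=
  LinearMap.range (toRees R E) ^ r

/-- `U` is a reduction of `E`: `𝓡(E)_{r+1} = U · 𝓡(E)_r` for some `r`. -/
def IsReduction {R : Type*} [CommRing R] {E : Type*} [AddCommGroup E] [Module R E]
    (U : Submodule R E) : Prop :=
  ∃ r : ℕ, reesPiece R E (r + 1) = U.map (toRees R E) * reesPiece R E r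

/-! ### The Nagata extension and generic Bourbaki ideals -/

/-- The extension `𝔪 R[Z]` of the maximal ideal of a local ring to a polynomial ring. -/
abbrev extendedMaximalIdeal (R : Type*) [CommRing R] [IsLocalRing R] (σ : Type*) :
    Ideal (MvPolynomial σ R) :=
  (IsLocalRing.maximalIdeal R).map (MvPolynomial.C : R →+* MvPolynomial σ R)

instance extendedMaximalIdeal_isPrime (R : Type*) [CommRing R] [IsLocalRing R] (σ : Type*) :
    (extendedMaximalIdeal R σ).IsPrime := by
  rw [← Ideal.Quotient.isDomain_iff_prime]
  exact (MvPolynomial.quotientEquivQuotientMvPolynomial (σ := σ)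
    (IsLocalRing.maximalIdeal R)).symm.toMulEquiv.isDomain _

/-- The Nagata extension `R(Z) = R[Z]_{𝔪 R[Z]}` of a local ring with respect to the set of
variables `Z` indexed by `σ`. -/
def Nagata (R : Type*) [CommRing R] [IsLocalRing R] (σ : Type*) : Type _ :=
  Localization.AtPrime (extendedMaximalIdeal R σ)

section NagataInstances

variable (R : Type*) [CommRing R] [IsLocalRing R] (σ : Type*)

instance : CommRing (Nagata R σ) :=
  inferInstanceAs (CommRing (Localization.AtPrime (extendedMaximalIdeal R σ)))

instance : Algebra (MvPolynomial σ R) (Nagata R σ) :=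
  inferInstanceAs (Algebra (MvPolynomial σ R) (Localization.AtPrime (extendedMaximalIdeal R σ)))

instance : IsLocalization.AtPrime (Nagata R σ) (extendedMaximalIdeal R σ) :=
  inferInstanceAs (IsLocalization.AtPrime (Localization.AtPrime (extendedMaximalIdeal R σ))
    (extendedMaximalIdeal R σ))

/-- `R(Z)` is an `R`-algebra through `R → R[Z] → R(Z)`. -/
instance : Algebra R (Nagata R σ) :=
  ((algebraMap (MvPolynomial σ R) (Nagata R σ)).comp
    (algebraMap R (MvPolynomial σ R))).toAlgebra

instance : IsScalarTower R (MvPolynomial σ R) (Nagata R σ) :=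
  IsScalarTower.of_algebraMap_eq' rfl

end NagataInstances

/-- The variable `z_s` as an element of the Nagata extension. -/
def nagataVar (R : Type*) [CommRing R] [IsLocalRing R] {σ : Type*} (s : σ) : Nagata R σ :=
  algebraMap (MvPolynomial σ R) (Nagata R σ) (MvPolynomial.X s)

section Generic

variable (R : Type*) [CommRing R] [IsLocalRing R] {E : Type*} [AddCommGroup E] [Module R E]
  {k : ℕ}

/-- The generic elements `x_j = ∑ i, z_{ij} a_i ∈ E'' = R'' ⊗ E`, `j = 1, …, l`, where
`R'' = R(Z)` for the `k × l` variables `z_{ij}`. -/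
def genericElement (a : Fin k → E) (l : ℕ) (j : Fin l) : Nagata R (Fin k × Fin l) ⊗[R] E :=
  ∑ i : Fin k, nagataVar R (i, j) ⊗ₜ[R] a i

/-- The submodule `F = ∑ j, R'' x_j` of `E''`. -/
def genericSubmodule (a : Fin k → E) (l : ℕ) :
    Submodule (Nagata R (Fin k × Fin l)) (Nagata R (Fin k × Fin l) ⊗[R] E) :=
  Submodule.span (Nagata R (Fin k × Fin l)) (Set.range (genericElement R a l))

/-- The quotient `E'' / F`. -/
abbrev GenericQuotient (a : Fin k → E) (l : ℕ) : Type _ :=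
  (Nagata R (Fin k × Fin l) ⊗[R] E) ⧸ genericSubmodule R a l

/-- The ideal `I` of `R''` is a generic Bourbaki ideal of `E` (of rank `e`) with respect to
`U = ∑ i, R a_i`, constructed from the generators `a_i`: with `l = e - 1`, the elements
`x_1, …, x_{e-1}` form a basis of `F`, the quotient `E'' / F` is torsion-free of rank one,
and `I ≅ E'' / F`. -/
structure IsGenericBourbakiIdeal (a : Fin k → E) (e : ℕ)
    (I : Ideal (Nagata R (Fin k × Fin (e - 1)))) : Prop where
  linearIndependent : LinearIndependent (Nagata R (Fin k × Fin (e - 1))) (genericElement R a (e - 1))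
  torsionFree : Module.IsTorsionFree (Nagata R (Fin k × Fin (e - 1))) (GenericQuotient R a (e - 1))
  rank_one : HasRank (Nagata R (Fin k × Fin (e - 1))) (GenericQuotient R a (e - 1)) 1
  equiv : Nonempty (GenericQuotient R a (e - 1) ≃ₗ[Nagata R (Fin k × Fin (e - 1))] I)

end Generic

end

end BourbakiFitting

namespace BourbakiFitting

open RingTheory.Sequence

/-! ### Weakly regular sequences and grade -/

section Grade

variable {A : Type*} [CommRing A]

/-! Write θ for the map of signed maximal minors. Cramer's rule gives, for all v and c, some w with
θ(c) v + ψ w = θ(v) c (`exists_minorMap_smul_add`). Modulo F the columns of ψ are relations among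
the classes of the y_i, so the map L from R''^(d+1) to E''/F satisfies θ(c) L(v) = θ(v) L(c). If
E''/F is torsion-free and the classes of the y_i have no common annihilator, L and θ have the same
kernel (`ker_linearCombination_eq`), whence E''/F ≅ I_d(ψ). The rank supplies the second condition:
θ(v) E'' lies in the span of the x_j and ∑ v_i y_i, so these e elements are independent once θ(v) is
a nonzerodivisor.

The deep point is that E''/F is torsion-free (`mem_genericSubmodule_of_smul_mem`). Let s u = ∑ f_j
x_j with s a nonzerodivisor; it suffices that s divides each f_j. At a prime q of R not containing
F_e(E), the module E is free and agrees with its reduction U. The coordinates of the x_j then form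
an e × (e-1) matrix of distinct variables shifted by forms in the remaining variables. Two of its
maximal minors have coprime lexicographic leading monomials, so they form a weakly regular pair, and
s divides f_j times each of them. Hence s divides f_j up to a factor outside q. It follows that
every element of F_e(E) has a power whose product with f_j is divisible by s, and grade F_e(E) ≥ 2
removes the factor.

If grade I_d(ψ) ≥ 2, Cramer's rule also makes the complex exact, as in the Hilbert–Burch theorem.
The ideal is proper because E is not free, so a splitting argument and a Koszul-type argument bound
its projective dimension below and its grade above. -/

theorem isWeaklyRegular_iff_mem (rs : List A) :
    IsWeaklyRegular A rs ↔ ∀ i (h : i < rs.length), ∀ x,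
      rs[i] * x ∈ Ideal.ofList (rs.take i) → x ∈ Ideal.ofList (rs.take i) := by
  rw [isWeaklyRegular_iff]
  refine forall₂_congr fun i h => ?_
  rw [isSMulRegular_quotient_iff_mem_of_smul_mem]
  simp

theorem isWeaklyRegular_pair_iff (a b : A) :
    IsWeaklyRegular A [a, b] ↔ (∀ x, a * x = 0 → x = 0) ∧ ∀ x, a ∣ b * x → a ∣ x := by
  rw [isWeaklyRegular_iff_mem]
  constructor
  · intro h
    refine ⟨fun x hx => ?_, fun x hx => ?_⟩
    · simpa using h 0 (by simp) x (by simpa using hx)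
    · simpa [Ideal.mem_span_singleton] using
        h 1 (by simp) x (by simpa [Ideal.mem_span_singleton] using hx)
  · rintro ⟨h₀, h₁⟩ i hi x hx
    have hi' : i < 2 := by simpa using hi
    interval_cases i
    · simpa using h₀ x (by simpa using hx)
    · simpa [Ideal.mem_span_singleton] using h₁ x (by simpa [Ideal.mem_span_singleton] using hx)

theorem isWeaklyRegular_take {rs : List A} (h : IsWeaklyRegular A rs) (n : ℕ) :
    IsWeaklyRegular A (rs.take n) := by
  rw [isWeaklyRegular_iff_mem] at h ⊢
  intro i hi x hx
  simp only [List.length_take, lt_min_iff] at hi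
  rw [List.take_take, min_eq_left hi.1.le] at hx ⊢
  rw [List.getElem_take] at hx
  exact h i hi.2 x hx

/-- A supremum of natural numbers that is at least n ≥ 1 cannot be bounded by n - 1, and a long
sequence can be truncated. -/
theorem exists_isWeaklyRegular_of_le_grade {I : Ideal A} {n : ℕ} (h : (n : ℕ∞) ≤ grade I) :
    ∃ rs : List A, rs.length = n ∧ IsWeaklyRegular A rs ∧ ∀ r ∈ rs, r ∈ I := by
  suffices ∃ rs : List A, n ≤ rs.length ∧ IsWeaklyRegular A rs ∧ ∀ r ∈ rs, r ∈ I by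
    obtain ⟨rs, hl, hw, hI⟩ := this
    exact ⟨rs.take n, by simpa using hl, isWeaklyRegular_take hw n,
      fun r hr => hI r (List.mem_of_mem_take hr)⟩
  rcases Nat.eq_zero_or_pos n with rfl | hn
  · exact ⟨[], le_rfl, IsWeaklyRegular.nil A A, by simp⟩
  by_contra! hcon
  have : grade I ≤ ((n - 1 : ℕ) : ℕ∞) := by
    refine iSup_le fun rs => iSup₂_le fun hw hI => ?_
    have : rs.length < n := by
      by_contra! hle
      obtain ⟨r, hr, hr'⟩ := hcon rs hle hw
      exact hr' (hI r hr)
    exact_mod_cast (by omega : rs.length ≤ n - 1)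
  have h' : (n : ℕ∞) ≤ ((n - 1 : ℕ) : ℕ∞) := h.trans this
  have h'' : n ≤ n - 1 := by exact_mod_cast h'
  omega

theorem exists_nonZeroDivisor_of_one_le_grade {I : Ideal A} (h : 1 ≤ grade I) :
    ∃ a ∈ I, ∀ x, a * x = 0 → x = 0 := by
  obtain ⟨rs, hl, hw, hI⟩ := exists_isWeaklyRegular_of_le_grade (n := 1) (by exact_mod_cast h)
  obtain ⟨a, rfl⟩ := List.length_eq_one_iff.1 hl
  refine ⟨a, hI a (by simp), fun x hx => ?_⟩
  simpa using (isWeaklyRegular_iff_mem _).1 hw 0 (by simp) x (by simpa using hx)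

theorem exists_pair_of_two_le_grade {I : Ideal A} (h : 2 ≤ grade I) :
    ∃ a ∈ I, ∃ b ∈ I, IsWeaklyRegular A [a, b] := by
  obtain ⟨rs, hl, hw, hI⟩ := exists_isWeaklyRegular_of_le_grade (n := 2) (by exact_mod_cast h)
  obtain ⟨a, b, rfl⟩ := List.length_eq_two.1 hl
  exact ⟨a, hI a (by simp), b, hI b (by simp), hw⟩

theorem exists_triple_of_two_lt_grade {I : Ideal A} (h : 2 < grade I) :
    ∃ a ∈ I, ∃ b ∈ I, ∃ c ∈ I, (∀ x, a * x = 0 → x = 0) ∧ (∀ x, a ∣ b * x → a ∣ x) ∧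
      ∀ x, (∃ p q, c * x = a * p + b * q) → ∃ p q, x = a * p + b * q := by
  obtain ⟨rs, hl, hw, hI⟩ := exists_isWeaklyRegular_of_le_grade (I := I) (n := 3)
    (le_of_eq_of_le (by norm_num) (Order.add_one_le_of_lt h))
  obtain ⟨a, b, c, rfl⟩ := List.length_eq_three.1 hl
  obtain ⟨h₀, h₁⟩ := (isWeaklyRegular_pair_iff a b).1 (isWeaklyRegular_take hw 2)
  refine ⟨a, hI a (by simp), b, hI b (by simp), c, hI c (by simp), h₀, h₁, fun x hx => ?_⟩
  have := (isWeaklyRegular_iff_mem _).1 hw 2 (by simp) x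
  simp only [List.getElem_cons_succ, List.getElem_cons_zero, List.take_succ_cons, List.take_zero,
    Ideal.ofList_cons, Ideal.ofList_nil, sup_bot_eq, ← Ideal.span_insert,
    Ideal.mem_span_pair] at this
  obtain ⟨p, q, hpq⟩ := hx
  obtain ⟨p', q', h'⟩ := this ⟨p, q, by rw [hpq]; ring⟩
  exact ⟨p', q', by rw [← h']; ring⟩

theorem dvd_of_pow_mul {a : A} (b : A) (hab : ∀ x, a ∣ b * x → a ∣ x) (n : ℕ) :
    ∀ x, a ∣ b ^ n * x → a ∣ x := by
  induction n with
  | zero => simp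
  | succ n ih => exact fun x hx => ih x (hab _ (by rwa [pow_succ', mul_assoc] at hx))

theorem isWeaklyRegular_pow_pair {a b : A} (h : IsWeaklyRegular A [a, b]) (m n : ℕ) :
    IsWeaklyRegular A [a ^ m, b ^ n] := by
  rw [isWeaklyRegular_pair_iff] at h ⊢
  obtain ⟨h₀, h₁⟩ := h
  refine ⟨?_, ?_⟩
  · induction m with
    | zero => simp
    | succ m ih => exact fun x hx => ih x (h₀ _ (by rw [← hx]; ring))
  · induction m with
    | zero => simp
    | succ m ih =>
      rintro x ⟨y, hy⟩
      obtain ⟨z, rfl⟩ := dvd_of_pow_mul b h₁ n x ⟨a ^ m * y, by rw [hy]; ring⟩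
      obtain ⟨w, rfl⟩ := ih z ⟨y, sub_eq_zero.1 (h₀ _ (by linear_combination hy))⟩
      exact ⟨w, by ring⟩

/-- If a nonzerodivisor `s` divides the multiples of `f` by a weakly regular pair, it
divides `f`. -/
theorem dvd_of_pair {a b s f : A} (hab : IsWeaklyRegular A [a, b])
    (hs : ∀ x, s * x = 0 → x = 0) (ha : s ∣ a * f) (hb : s ∣ b * f) : s ∣ f := by
  obtain ⟨h₀, h₁⟩ := (isWeaklyRegular_pair_iff a b).1 hab
  obtain ⟨p, hp⟩ := ha
  obtain ⟨q, hq⟩ := hb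
  obtain ⟨p', rfl⟩ := h₁ p ⟨q, sub_eq_zero.1 (hs _ (by linear_combination b * hp * (-1) + a * hq))⟩
  exact ⟨p', sub_eq_zero.1 (h₀ _ (by linear_combination hp))⟩

end Grade

/-! ### The complex of maximal minors -/

section Minors

open Matrix

variable {A : Type*} [CommRing A] {d : ℕ} (ψ : Matrix (Fin (d + 1)) (Fin d) A)

/-- The square matrix obtained from `ψ` by adding the column `v` in front. -/
def consCol (v : Fin (d + 1) → A) : Matrix (Fin (d + 1)) (Fin (d + 1)) A :=
  Matrix.of fun i => Fin.cons (v i) (ψ i)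

theorem minorMap_apply (v : Fin (d + 1) → A) :
    minorMap ψ v = ∑ i, v i * signedMinor ψ i := by
  simp [minorMap, Fintype.linearCombination_apply]

theorem minorMap_single (i : Fin (d + 1)) : minorMap ψ (Pi.single i 1) = signedMinor ψ i := by
  simp [minorMap]

theorem det_consCol (v : Fin (d + 1) → A) : (consCol ψ v).det = minorMap ψ v := by
  rw [det_succ_column_zero, minorMap_apply]
  refine Finset.sum_congr rfl fun i _ => ?_
  have : (consCol ψ v).submatrix i.succAbove Fin.succ = ψ.submatrix i.succAbove id := by
    ext; simp [consCol]
  rw [this, signedMinor]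
  simp [consCol]
  ring

theorem adjugate_consCol (v : Fin (d + 1) → A) (k : Fin (d + 1)) :
    (consCol ψ v).adjugate 0 k = signedMinor ψ k := by
  rw [adjugate_fin_succ_eq_det_submatrix, signedMinor]
  have : (consCol ψ v).submatrix k.succAbove (Fin.succAbove 0) = ψ.submatrix k.succAbove id := by
    ext; simp [consCol]
  rw [this]
  simp

/-- This is column k of M · adj M = det M for M = (v | ψ): the top row of adj M consists of the
signed minors, its other rows supply w. -/
theorem exists_signedMinor_smul_add (v : Fin (d + 1) → A) (k : Fin (d + 1)) :
    ∃ w, signedMinor ψ k • v + ψ *ᵥ w = minorMap ψ v • Pi.single k 1 := by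
  refine ⟨fun j => (consCol ψ v).adjugate j.succ k, funext fun i => ?_⟩
  have h := congrFun (congrFun (mul_adjugate (consCol ψ v)) i) k
  rw [mul_apply, Fin.sum_univ_succ, adjugate_consCol, det_consCol] at h
  simp only [Pi.add_apply, Pi.smul_apply, smul_eq_mul, mulVec, dotProduct]
  simp only [Matrix.smul_apply, smul_eq_mul, one_apply] at h
  rw [Pi.single_apply, ← h]
  simp [consCol, Matrix.of_apply, mul_comm]

/-- Cramer's rule for the maximal minors of a `(d + 1) × d` matrix. -/
theorem exists_minorMap_smul_add (v c : Fin (d + 1) → A) :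
    ∃ w, minorMap ψ c • v + ψ *ᵥ w = minorMap ψ v • c := by
  choose w hw using exists_signedMinor_smul_add ψ v
  refine ⟨∑ k, c k • w k, ?_⟩
  have h : ∑ k, c k • (signedMinor ψ k • v + ψ *ᵥ w k) =
      ∑ k, c k • (minorMap ψ v • (Pi.single k 1 : Fin (d + 1) → A)) :=
    Finset.sum_congr rfl fun k _ => by rw [hw]
  have e₁ : ∑ k, c k • (minorMap ψ v • (Pi.single k 1 : Fin (d + 1) → A)) =
      minorMap ψ v • c := by
    conv_rhs => rw [← Finset.univ_sum_single c]
    rw [Finset.smul_sum]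
    refine Finset.sum_congr rfl fun k _ => ?_
    rw [smul_comm, ← Pi.single_smul, smul_eq_mul, mul_one]
  rw [← e₁, ← h]
  simp only [smul_add, Finset.sum_add_distrib, minorMap_apply, Finset.sum_smul, smul_smul]
  congr 1
  rw [← mulVecLin_apply, map_sum]
  simp

theorem minorMap_comp_mulVecLin : minorMap ψ ∘ₗ ψ.mulVecLin = 0 := by
  refine LinearMap.pi_ext' fun j => LinearMap.ext_ring ?_
  simp only [LinearMap.comp_apply, LinearMap.zero_apply, LinearMap.single_apply, mulVecLin_apply,
    mulVec_single_one]
  rw [← det_consCol]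
  exact det_zero_of_column_eq (i := 0) (j := j.succ) (Fin.succ_ne_zero j).symm
    (by simp [consCol])

theorem minorMap_mulVec (w : Fin d → A) : minorMap ψ (ψ *ᵥ w) = 0 :=
  LinearMap.congr_fun (minorMap_comp_mulVecLin ψ) w

theorem range_minorMap : LinearMap.range (minorMap ψ) = minorIdeal d ψ := by
  rw [minorMap, Fintype.range_linearCombination]
  apply le_antisymm
  · refine Submodule.span_le.2 ?_
    rintro _ ⟨i, rfl⟩
    exact Ideal.mul_mem_left _ _ (Ideal.subset_span ⟨(i.succAbove, id), rfl⟩)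
  · refine Submodule.span_le.2 ?_
    rintro _ ⟨⟨r, c⟩, rfl⟩
    by_cases hr : Function.Injective r
    · obtain ⟨i, hi⟩ : ∃ i, i ∉ Set.range r := by
        by_contra! hcon
        have := Fintype.card_le_of_surjective r hcon
        simp at this
      choose σ hσ using fun j => Fin.exists_succAbove_eq (x := r j) (y := i)
        (fun h => hi ⟨j, h⟩)
      -- An injective r misses exactly one row i. The outer factors record the reordering σ of the
      -- other rows and the choice c of columns.
      have h : ψ.submatrix r c = (1 : Matrix (Fin d) (Fin d) A).submatrix σ id *
          ψ.submatrix i.succAbove id * (1 : Matrix (Fin d) (Fin d) A).submatrix id c := by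
        ext a b
        simp [mul_apply, one_apply, hσ]
      have h' : (ψ.submatrix r c).det = (((1 : Matrix (Fin d) (Fin d) A).submatrix σ id).det *
          ((1 : Matrix (Fin d) (Fin d) A).submatrix id c).det * (-1) ^ (i : ℕ)) *
            signedMinor ψ i := by
        rw [h, det_mul, det_mul, signedMinor]
        have : ((-1 : A) ^ (i : ℕ)) * (-1) ^ (i : ℕ) = 1 := by
          rw [← mul_pow]; simp
        linear_combination -(((1 : Matrix (Fin d) (Fin d) A).submatrix σ id).det *
          ((1 : Matrix (Fin d) (Fin d) A).submatrix id c).det *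
            (ψ.submatrix i.succAbove id).det) * this
      simp only [h']
      exact Submodule.smul_mem _ _ (Submodule.subset_span ⟨i, rfl⟩)
    · rw [Function.Injective] at hr
      push Not at hr
      obtain ⟨a, b, hab, hne⟩ := hr
      have : (ψ.submatrix r c).det = 0 :=
        det_zero_of_row_eq hne (by ext; simp [hab])
      simp [this]

theorem exists_minorMap_eq {x : A} (hx : x ∈ minorIdeal d ψ) : ∃ v, minorMap ψ v = x := by
  rwa [← range_minorMap] at hx

theorem minorMap_mem (v : Fin (d + 1) → A) : minorMap ψ v ∈ minorIdeal d ψ := by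
  rw [← range_minorMap]; exact ⟨v, rfl⟩

/-- By the adjugate identity every maximal minor kills a vector of the kernel, hence so does the
nonzerodivisor a. -/
theorem mulVecLin_injective {a : A} (haI : a ∈ minorIdeal d ψ) (ha : ∀ x, a * x = 0 → x = 0) :
    Function.Injective ψ.mulVecLin := by
  rw [injective_iff_map_eq_zero]
  intro w hw
  have key : ∀ i j, signedMinor ψ i * w j = 0 := by
    intro i j
    have h₁ : (ψ.submatrix i.succAbove id) *ᵥ w = 0 := by
      ext k
      exact congrFun hw (i.succAbove k)
    have h₂ : (ψ.submatrix i.succAbove id).det • w = 0 := by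
      rw [← one_mulVec w, ← smul_mulVec, ← adjugate_mul, ← mulVec_mulVec, h₁, mulVec_zero]
    have := congrFun h₂ j
    simp only [Pi.smul_apply, smul_eq_mul, Pi.zero_apply] at this
    rw [signedMinor, mul_assoc, this, mul_zero]
  obtain ⟨v, rfl⟩ := exists_minorMap_eq ψ haI
  ext j
  apply ha
  rw [minorMap_apply, Finset.sum_mul]
  exact Finset.sum_eq_zero fun i _ => by rw [mul_assoc, key, mul_zero]

/-- If θ(v) = 0, Cramer's rule puts I_d(ψ) v in the image of ψ. From a v = ψ p and b v = ψ q
injectivity gives b p = a q, so p = a z by regularity, and a cancels to leave v = ψ z. -/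
theorem exact_of_pair {a b : A} (haI : a ∈ minorIdeal d ψ) (hbI : b ∈ minorIdeal d ψ)
    (hab : IsWeaklyRegular A [a, b]) : Function.Exact ψ.mulVecLin (minorMap ψ) := by
  obtain ⟨h₀, h₁⟩ := (isWeaklyRegular_pair_iff a b).1 hab
  intro v
  refine ⟨fun hv => ?_, ?_⟩
  · have key : ∀ c ∈ minorIdeal d ψ, ∃ w, ψ *ᵥ w = c • v := by
      intro c hc
      obtain ⟨u, rfl⟩ := exists_minorMap_eq ψ hc
      obtain ⟨w, hw⟩ := exists_minorMap_smul_add ψ v u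
      refine ⟨-w, ?_⟩
      rw [hv, zero_smul] at hw
      rw [mulVec_neg, neg_eq_iff_add_eq_zero, add_comm (ψ *ᵥ w), hw]
    obtain ⟨p, hp⟩ := key a haI
    obtain ⟨q, hq⟩ := key b hbI
    have hpq : b • p = a • q := by
      apply mulVecLin_injective ψ haI h₀
      simp only [mulVecLin_apply, mulVec_smul, hp, hq]
      rw [smul_comm]
    choose z hz using fun j => h₁ (p j) ⟨q j, congrFun hpq j⟩
    refine ⟨z, ?_⟩
    have hz' : p = a • z := funext hz
    rw [hz', mulVec_smul] at hp
    ext i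
    exact sub_eq_zero.1 (h₀ _ (by
      have := congrFun hp i
      simp only [Pi.smul_apply, smul_eq_mul] at this
      rw [mulVecLin_apply, mul_sub, this, sub_self]))
  · rintro ⟨w, rfl⟩
    exact minorMap_mulVec ψ w

/-- An ideal of maximal minors with a resolution of length two containing a weakly regular
sequence of length three is the unit ideal. -/
theorem grade_minorIdeal_le_two (hexact : Function.Exact ψ.mulVecLin (minorMap ψ))
    (htop : minorIdeal d ψ ≠ ⊤) : grade (minorIdeal d ψ) ≤ 2 := by
  by_contra! hlt
  obtain ⟨a, haI, b, hbI, c, hcI, h₀, h₁, h₂⟩ := exists_triple_of_two_lt_grade hlt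
  have hinj := mulVecLin_injective ψ haI h₀
  obtain ⟨v, hv⟩ := exists_minorMap_eq ψ haI
  obtain ⟨vb, hvb⟩ := exists_minorMap_eq ψ hbI
  obtain ⟨vc, hvc⟩ := exists_minorMap_eq ψ hcI
  obtain ⟨w, hw⟩ := (hexact (b • v - a • vb)).1 (by simp [hv, hvb, mul_comm])
  obtain ⟨w', hw'⟩ := (hexact (c • v - a • vc)).1 (by simp [hv, hvc, mul_comm])
  obtain ⟨w'', hw''⟩ := (hexact (c • vb - b • vc)).1 (by simp [hvb, hvc, mul_comm])
  -- The Koszul relation among the three syzygies, lifted along the injective ψ. As c is regular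
  -- modulo (a, b), it forces w = a p + b q.
  have hrel : b • w' - c • w = a • w'' := by
    apply hinj
    rw [map_sub, map_smul, map_smul, map_smul, hw, hw', hw'']
    module
  have hmem : ∀ j, ∃ p q, w j = a * p + b * q := fun j => h₂ _ ⟨-w'' j, w' j, by
    have := congrFun hrel j
    simp only [Pi.sub_apply, Pi.smul_apply, smul_eq_mul] at this
    linear_combination -this⟩
  choose p q hpq using hmem
  have hpq' : w = a • p + b • q := funext hpq
  -- Regularity of b modulo a now gives v - ψ q = a u, and applying θ yields a = a θ(u), so that
  -- θ(u) = 1.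
  have h₃ : b • (v - ψ *ᵥ q) = a • (vb + ψ *ᵥ p) := by
    rw [hpq', map_add, map_smul, map_smul, mulVecLin_apply, mulVecLin_apply] at hw
    refine sub_eq_zero.1 ?_
    calc _ = -(a • ψ *ᵥ p + b • ψ *ᵥ q - (b • v - a • vb)) := by module
      _ = 0 := by rw [hw, sub_self, neg_zero]
  choose u hu using fun i => h₁ ((v - ψ *ᵥ q) i) ⟨_, congrFun h₃ i⟩
  have hu' : v - ψ *ᵥ q = a • u := funext hu
  have h₄ := congrArg (minorMap ψ) hu'
  rw [map_sub, minorMap_mulVec, hv, map_smul, sub_zero, smul_eq_mul] at h₄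
  have h₅ : minorMap ψ u = 1 := sub_eq_zero.1 (h₀ _ (by linear_combination -h₄))
  exact htop ((Ideal.eq_top_iff_one _).2 (h₅ ▸ minorMap_mem ψ u))

/-- A section s of θ satisfies b s(a) = a s(b). Comparing coordinates, s(a) = a u for some u in F,
so a = a θ(u) and 1 lies in I. -/
theorem not_projective_of_pair {I : Ideal A} {F : Type*} [AddCommGroup F] [Module A F]
    (θ : F →ₗ[A] A) (hθ : LinearMap.range θ = I) (hI : I ≠ ⊤) {a b : A} (haI : a ∈ I)
    (hbI : b ∈ I) (hab : IsWeaklyRegular A [a, b]) [Module.Finite A F] [Module.Free A F] :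
    ¬ Module.Projective A I := by
  intro hproj
  obtain ⟨h₀, h₁⟩ := (isWeaklyRegular_pair_iff a b).1 hab
  obtain ⟨s, hs⟩ := Module.projective_lifting_property
    (θ.codRestrict I fun v => hθ ▸ ⟨v, rfl⟩) LinearMap.id (by
      rintro ⟨x, hx⟩
      rw [← hθ] at hx
      obtain ⟨v, rfl⟩ := hx
      exact ⟨v, rfl⟩)
  have hs' : ∀ x : I, θ (s x) = x := fun x => congrArg Subtype.val (LinearMap.congr_fun hs x)
  have hsab : b • s ⟨a, haI⟩ = a • s ⟨b, hbI⟩ := by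
    rw [← map_smul, ← map_smul]
    congr 1
    ext
    simp [mul_comm]
  let B := Module.Free.chooseBasis A F
  choose u hu using fun i => h₁ (B.repr (s ⟨a, haI⟩) i)
    ⟨B.repr (s ⟨b, hbI⟩) i, by simpa using congrArg (fun v => B.repr v i) hsab⟩
  have hsa : s ⟨a, haI⟩ = a • ∑ i, u i • B i := by
    rw [← B.sum_repr (s ⟨a, haI⟩), Finset.smul_sum]
    exact Finset.sum_congr rfl fun i _ => by rw [hu, mul_smul]
  have h₂ := hs' ⟨a, haI⟩
  rw [hsa, map_smul, smul_eq_mul] at h₂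
  have h₃ : θ (∑ i, u i • B i) = 1 := sub_eq_zero.1 (h₀ _ (by linear_combination h₂))
  exact hI ((Ideal.eq_top_iff_one _).2 (hθ ▸ ⟨_, h₃⟩))

open CategoryTheory in
-- Dimension shifting along 0 → I → A → A/I → 0 and 0 → A^d → A^(d+1) → I → 0 gives projective
-- dimension at most 2; a smaller value would make I projective.
theorem isPerfectOfGrade_two (hI : minorIdeal d ψ ≠ ⊤) (hgrade : 2 ≤ grade (minorIdeal d ψ)) :
    IsPerfectOfGrade (minorIdeal d ψ) 2 := by
  obtain ⟨a, haI, b, hbI, hab⟩ := exists_pair_of_two_le_grade hgrade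
  have hexact := exact_of_pair ψ haI hbI hab
  have hinj := mulVecLin_injective ψ haI ((isWeaklyRegular_pair_iff a b).1 hab).1
  refine ⟨le_antisymm (grade_minorIdeal_le_two ψ hexact hI) hgrade, ?_⟩
  let θ : (Fin (d + 1) → A) →ₗ[A] minorIdeal d ψ :=
    (minorMap ψ).codRestrict _ fun v => minorMap_mem ψ v
  have hθ : Function.Surjective θ := by
    rintro ⟨x, hx⟩
    obtain ⟨v, rfl⟩ := exists_minorMap_eq ψ hx
    exact ⟨v, rfl⟩
  let S₁ : ShortComplex (ModuleCat A) := .mk (ModuleCat.ofHom (minorIdeal d ψ).subtype)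
    (ModuleCat.ofHom (minorIdeal d ψ).mkQ)
    (ModuleCat.hom_ext (LinearMap.range_le_ker_iff.1
      ((Submodule.range_subtype _).trans (Submodule.ker_mkQ _).symm).le))
  have hS₁ : S₁.ShortExact :=
    { exact := (ShortComplex.moduleCat_exact_iff_range_eq_ker _).2
        ((Submodule.range_subtype _).trans (Submodule.ker_mkQ _).symm)
      mono_f := (ModuleCat.mono_iff_injective _).2 (Submodule.injective_subtype _)
      epi_g := (ModuleCat.epi_iff_surjective _).2 (Submodule.mkQ_surjective _) }
  have hθker : LinearMap.range ψ.mulVecLin = LinearMap.ker θ := by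
    rw [LinearMap.ker_codRestrict]
    exact (LinearMap.exact_iff.1 hexact).symm
  let S₂ : ShortComplex (ModuleCat A) := .mk (ModuleCat.ofHom ψ.mulVecLin) (ModuleCat.ofHom θ)
    (ModuleCat.hom_ext (LinearMap.range_le_ker_iff.1 hθker.le))
  have hS₂ : S₂.ShortExact :=
    { exact := (ShortComplex.moduleCat_exact_iff_range_eq_ker _).2 hθker
      mono_f := (ModuleCat.mono_iff_injective _).2 hinj
      epi_g := (ModuleCat.epi_iff_surjective _).2 hθ }
  have hp₁ : Projective S₁.X₂ := inferInstanceAs (Projective (ModuleCat.of A A))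
  have hp₂ : Projective S₂.X₁ := inferInstanceAs (Projective (ModuleCat.of A (Fin d → A)))
  have hp₃ : Projective S₂.X₂ := inferInstanceAs (Projective (ModuleCat.of A (Fin (d + 1) → A)))
  have hlt : HasProjectiveDimensionLT S₁.X₁ 2 :=
    hS₂.hasProjectiveDimensionLT_X₃ 1 inferInstance inferInstance
  refine le_antisymm ((projectiveDimension_le_iff _ 2).2
    ((hS₁.hasProjectiveDimensionLT_X₃_iff 1 hp₁).2 hlt))
    ((projectiveDimension_ge_iff _ 2).2 fun h => ?_)
  have hlt₁ : HasProjectiveDimensionLT S₁.X₁ 1 :=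
    (hS₁.hasProjectiveDimensionLT_X₃_iff 0 hp₁).1 h
  have hproj : Projective (ModuleCat.of A (minorIdeal d ψ)) :=
    projective_iff_hasProjectiveDimensionLT_one.2 hlt₁
  exact not_projective_of_pair (minorMap ψ) (range_minorMap ψ) hI haI hbI hab
    ((IsProjective.iff_projective _).2 hproj)

/-! ### Modules generated by d + 1 elements with the columns of ψ as relations -/

section Quotient

variable {N : Type*} [AddCommGroup N] [Module A N] (y : Fin (d + 1) → N)

/-- Both inclusions apply L to Cramer's rule, which gives θ(c) L(v) = θ(v) L(c): once with c a basis
vector, using that the y_i have no common annihilator, once with θ(c) = a regular on N. -/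
theorem ker_linearCombination_eq (hrel : Fintype.linearCombination A y ∘ₗ ψ.mulVecLin = 0)
    {a : A} (haI : a ∈ minorIdeal d ψ) (ha : ∀ x : N, a • x = 0 → x = 0)
    (hfaith : ∀ r : A, (∀ i, r • y i = 0) → r = 0) :
    LinearMap.ker (Fintype.linearCombination A y) = LinearMap.ker (minorMap ψ) := by
  have hrel' : ∀ w, Fintype.linearCombination A y (ψ *ᵥ w) = 0 := LinearMap.congr_fun hrel
  ext v
  rw [LinearMap.mem_ker, LinearMap.mem_ker]
  constructor
  · intro hv
    refine hfaith _ fun i => ?_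
    obtain ⟨w, hw⟩ := exists_minorMap_smul_add ψ v (Pi.single i 1)
    have := congrArg (Fintype.linearCombination A y) hw
    rw [map_add, map_smul, map_smul, hv, hrel', smul_zero, add_zero] at this
    simpa using this.symm
  · intro hv
    obtain ⟨c, rfl⟩ := exists_minorMap_eq ψ haI
    obtain ⟨w, hw⟩ := exists_minorMap_smul_add ψ v c
    have := congrArg (Fintype.linearCombination A y) hw
    rw [map_add, map_smul, map_smul, hv, hrel', zero_smul, add_zero] at this
    exact ha _ this

theorem exists_equiv_minorIdeal (hy : Submodule.span A (Set.range y) = ⊤)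
    (hker : LinearMap.ker (Fintype.linearCombination A y) = LinearMap.ker (minorMap ψ)) :
    ∃ g : N ≃ₗ[A] minorIdeal d ψ, ∀ i, (g (y i) : A) = signedMinor ψ i := by
  have hsurj : Function.Surjective (Fintype.linearCombination A y) := by
    rw [← LinearMap.range_eq_top, Fintype.range_linearCombination, hy]
  let g := (LinearMap.quotKerEquivOfSurjective _ hsurj).symm ≪≫ₗ
    Submodule.quotEquivOfEq _ _ hker ≪≫ₗ (minorMap ψ).quotKerEquivRange ≪≫ₗ
      LinearEquiv.ofEq _ _ (range_minorMap ψ)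
  refine ⟨g, fun i => ?_⟩
  have : (LinearMap.quotKerEquivOfSurjective _ hsurj).symm (y i) =
      Submodule.Quotient.mk (Pi.single i 1) := by
    rw [LinearEquiv.symm_apply_eq]
    simp [LinearMap.quotKerEquivOfSurjective]
  simp only [g, LinearEquiv.trans_apply, this]
  rw [← minorMap_single]
  rfl

end Quotient

end Minors

/-! ### Maximal minors of generic matrices -/

section GenericMinors

open MvPolynomial MonomialOrder

/-- Polynomials with coprime leading monomials and leading coefficients `1` form a weakly regular
sequence. -/
theorem isWeaklyRegular_of_monic {A σ : Type*} [CommRing A] (m : MonomialOrder σ)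
    {f g : MvPolynomial σ A} (hf : m.Monic f) (hg : m.Monic g)
    (hfg : ∀ i, m.degree f i = 0 ∨ m.degree g i = 0) : IsWeaklyRegular (MvPolynomial σ A) [f, g] := by
  have hf' : IsRegular (m.leadingCoeff f) := by
    rw [hf.leadingCoeff_eq_one]; exact isRegular_one
  have hg' : IsRegular (m.leadingCoeff g) := by
    rw [hg.leadingCoeff_eq_one]; exact isRegular_one
  have hf₀ : ∀ x, f * x = 0 → x = 0 := fun x hx => by
    have := m.leadingCoeff_mul_of_isRegular_left (g := x) hf'
    rw [hx, hf.leadingCoeff_eq_one, one_mul, m.leadingCoeff_zero] at this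
    exact m.leadingCoeff_eq_zero_iff.1 this.symm
  have hg₀ : ∀ x, g * x = 0 → x = 0 := fun x hx => by
    have := m.leadingCoeff_mul_of_isRegular_left (g := x) hg'
    rw [hx, hg.leadingCoeff_eq_one, one_mul, m.leadingCoeff_zero] at this
    exact m.leadingCoeff_eq_zero_iff.1 this.symm
  refine (isWeaklyRegular_pair_iff f g).2 ⟨hf₀, ?_⟩
  rintro x ⟨y, hy⟩
  obtain ⟨q, r, rfl, -, hr⟩ := m.div_single (b := f)
    (by rw [hf.leadingCoeff_eq_one]; exact isUnit_one) x
  -- The remainder r has no monomial divisible by the leading monomial of f. By coprimality this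
  -- relation would make that monomial divide the leading monomial of r.
  have hrel : g * r = f * (y - g * q) := by linear_combination hy
  by_cases hr₀ : r = 0
  · exact ⟨q, by rw [hr₀]; ring⟩
  exfalso
  have hp₀ : y - g * q ≠ 0 := fun h => hr₀ (hg₀ _ (by rw [hrel, h, mul_zero]))
  have hdeg := congrArg m.degree hrel
  rw [m.degree_mul_of_isRegular_left hg' hr₀, m.degree_mul_of_isRegular_left hf' hp₀] at hdeg
  refine hr _ (m.degree_mem_support hr₀) fun i => ?_
  have := DFunLike.congr_fun hdeg i
  simp only [Finsupp.add_apply] at this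
  rcases hfg i with h | h <;> omega

/-! ### Leading monomials of the maximal minors of a generic matrix -/

variable {A : Type*} [CommRing A] {n : ℕ}

/-- The exponent of the monomial `∏ i, X (r i, τ i)`. -/
noncomputable def permExponent (r : Fin n → Fin (n + 1)) (τ : Equiv.Perm (Fin n)) :
    (Fin (n + 1) ×ₗ Fin n) →₀ ℕ :=
  ∑ i, Finsupp.single (toLex (r i, τ i)) 1

theorem permExponent_apply {r : Fin n → Fin (n + 1)} (hr : StrictMono r)
    (τ : Equiv.Perm (Fin n)) (i j : Fin n) :
    permExponent r τ (toLex (r i, j)) = if τ i = j then 1 else 0 := by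
  simp only [permExponent, Finsupp.finsetSum_apply, Finsupp.single_apply,
    EmbeddingLike.apply_eq_iff_eq, Prod.mk.injEq, hr.injective.eq_iff]
  rw [Finset.sum_eq_single i]
  · simp
  · intro b _ hb
    simp [hb]
  · simp

theorem permExponent_apply_of_notMem {r : Fin n → Fin (n + 1)}
    (τ : Equiv.Perm (Fin n)) {l : Fin (n + 1)} (hl : l ∉ Set.range r) (j : Fin n) :
    permExponent r τ (toLex (l, j)) = 0 := by
  simp only [permExponent, Finsupp.finsetSum_apply, Finsupp.single_apply,
    EmbeddingLike.apply_eq_iff_eq, Prod.mk.injEq]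
  refine Finset.sum_eq_zero fun i _ => if_neg fun h => hl ⟨i, h.1⟩

/-- Let i be the least index moved by τ; then τ i > i. The variable (r i, i) is the first at which
the exponents differ, and only the diagonal monomial contains it. -/
theorem permExponent_lt {r : Fin n → Fin (n + 1)} (hr : StrictMono r) {τ : Equiv.Perm (Fin n)}
    (hτ : τ ≠ 1) : permExponent r τ ≺[lex] permExponent r 1 := by
  rw [MonomialOrder.lex_lt_iff]
  have hex : (Finset.univ.filter fun i => τ i ≠ i).Nonempty := by
    by_contra h
    rw [Finset.not_nonempty_iff_eq_empty, Finset.filter_eq_empty_iff] at h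
    exact hτ (Equiv.ext fun i => by simpa using h (Finset.mem_univ i))
  obtain ⟨i, hi, hmin⟩ := Finset.exists_min_image _ id hex
  have hlt : ∀ j < i, τ j = j := fun j hj => by
    by_contra h
    exact absurd (hmin j (by simpa using h)) (not_le.2 hj)
  have hτi : τ i ≠ i := by simpa using hi
  have hi' : i < τ i := lt_of_le_of_ne (by
    by_contra! h
    exact hτi (τ.injective (hlt _ h))) hτi.symm
  refine ⟨toLex (r i, i), ?_, ?_⟩
  · rintro ⟨l, j⟩ hlj
    change permExponent r τ (toLex (l, j)) = permExponent r 1 (toLex (l, j))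
    by_cases hl : l ∈ Set.range r
    · obtain ⟨i', rfl⟩ := hl
      rw [permExponent_apply hr, permExponent_apply hr]
      rcases (Prod.Lex.toLex_lt_toLex.1 hlj) with h | ⟨h, h'⟩
      · rw [hlt i' (hr.lt_iff_lt.1 h)]
        rfl
      · obtain rfl := hr.injective h
        have h' : j < i' := h'
        rw [if_neg (h'.trans hi').ne', if_neg]
        exact h'.ne'
    · rw [permExponent_apply_of_notMem τ hl, permExponent_apply_of_notMem 1 hl]
  · change permExponent r τ (toLex (r i, i)) < permExponent r 1 (toLex (r i, i))
    rw [permExponent_apply hr, permExponent_apply hr, if_neg hτi]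
    simp

/-- The generic `(n + 1) × n` matrix, shifted by a matrix of constants. -/
noncomputable def shiftedGeneric (c : Fin (n + 1) → Fin n → A) :
    Matrix (Fin (n + 1)) (Fin n) (MvPolynomial (Fin (n + 1) ×ₗ Fin n) A) :=
  Matrix.of fun l j => X (toLex (l, j)) + C (c l j)

theorem det_shiftedGeneric [Nontrivial A] (hn : 0 < n) (c : Fin (n + 1) → Fin n → A)
    {r : Fin n → Fin (n + 1)} (hr : StrictMono r) :
    (lex (σ := Fin (n + 1) ×ₗ Fin n)).Monic ((shiftedGeneric c).submatrix r id).det ∧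
      (lex (σ := Fin (n + 1) ×ₗ Fin n)).degree ((shiftedGeneric c).submatrix r id).det =
        permExponent r 1 := by
  set m := lex (σ := Fin (n + 1) ×ₗ Fin n)
  let t : Equiv.Perm (Fin n) → MvPolynomial (Fin (n + 1) ×ₗ Fin n) A := fun τ =>
    ∏ i, (X (toLex (r i, τ i)) + C (c (r i) (τ i)))
  have ht : ∀ τ, m.degree (t τ) = permExponent r τ := fun τ => by
    rw [m.degree_prod_of_regular fun i _ => by
      rw [(m.monic_X_add_C _ _).leadingCoeff_eq_one]; exact isRegular_one]
    exact Finset.sum_congr rfl fun i _ => m.degree_X_add_C _ _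
  have ht₁ : m.Monic (t 1) := Monic.prod fun i _ => m.monic_X_add_C _ _
  have hdet : ((shiftedGeneric c).submatrix r id).det =
      t 1 + ∑ τ ∈ Finset.univ.erase 1, ((Equiv.Perm.sign τ : ℤ) : MvPolynomial _ A) * t τ := by
    rw [← Matrix.det_transpose, Matrix.det_apply', ← Finset.add_sum_erase _ _ (Finset.mem_univ 1)]
    simp [t, shiftedGeneric]
  have hlt : m.degree (∑ τ ∈ Finset.univ.erase 1,
      ((Equiv.Perm.sign τ : ℤ) : MvPolynomial _ A) * t τ) ≺[m] m.degree (t 1) := by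
    rw [ht, m.degree_lt_iff]
    · intro b hb
      obtain ⟨τ, hτ, hb'⟩ := Finset.mem_biUnion.1 (support_sum hb)
      have hb'' : b ∈ (t τ).support := by
        rcases Int.units_eq_one_or (Equiv.Perm.sign τ) with h | h <;> simpa [h] using hb'
      refine lt_of_le_of_lt ?_ (permExponent_lt hr (Finset.ne_of_mem_erase hτ))
      rw [← ht τ]
      exact m.le_degree hb''
    -- The degree comparison requires a nonconstant diagonal monomial, which holds because 0 < n.
    · rw [map_zero, m.toSyn_lt_iff_ne_zero]
      intro h
      rw [m.toSyn_eq_zero_iff] at h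
      have := DFunLike.congr_fun h (toLex (r ⟨0, hn⟩, ⟨0, hn⟩))
      rw [permExponent_apply hr] at this
      simp at this
  rw [hdet]
  exact ⟨ht₁.add_of_lt hlt, by rw [m.degree_add_of_lt hlt, ht]⟩

/-- Deleting the last or the first row gives minors with leading monomials ∏ X(j, j) and ∏ X(j+1,
j), which share no variable. -/
theorem isWeaklyRegular_shiftedGeneric [Nontrivial A] (hn : 0 < n) (c : Fin (n + 1) → Fin n → A) :
    IsWeaklyRegular (MvPolynomial (Fin (n + 1) ×ₗ Fin n) A)
      [((shiftedGeneric c).submatrix Fin.castSucc id).det,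
        ((shiftedGeneric c).submatrix Fin.succ id).det] := by
  obtain ⟨h₁, h₂⟩ := det_shiftedGeneric hn c Fin.strictMono_castSucc
  obtain ⟨h₃, h₄⟩ := det_shiftedGeneric hn c Fin.strictMono_succ
  refine isWeaklyRegular_of_monic _ h₁ h₃ ?_
  rintro ⟨l, j⟩
  rw [h₂, h₄]
  change permExponent _ 1 (toLex (l, j)) = 0 ∨ permExponent _ 1 (toLex (l, j)) = 0
  by_cases hl : l = j.succ
  · subst hl
    by_cases hl' : j.succ ∈ Set.range (Fin.castSucc : Fin n → Fin (n + 1))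
    · obtain ⟨i, hi⟩ := hl'
      left
      rw [← hi, permExponent_apply Fin.strictMono_castSucc]
      refine if_neg fun h => ?_
      have := congrArg Fin.val hi
      have h' : i = j := h
      rw [h'] at this
      simp at this
    · exact Or.inl (permExponent_apply_of_notMem 1 hl' j)
  · by_cases hl' : l ∈ Set.range (Fin.succ : Fin n → Fin (n + 1))
    · obtain ⟨i, rfl⟩ := hl'
      right
      rw [permExponent_apply Fin.strictMono_succ]
      refine if_neg fun h => hl ?_
      have h' : i = j := h
      rw [h']
    · exact Or.inr (permExponent_apply_of_notMem 1 hl' j)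

theorem isWeaklyRegular_pair_of_ringEquiv {A B : Type*} [CommRing A] [CommRing B] (Φ : A ≃+* B)
    {a b : A} (h : IsWeaklyRegular B [Φ a, Φ b]) : IsWeaklyRegular A [a, b] := by
  obtain ⟨h₀, h₁⟩ := (isWeaklyRegular_pair_iff _ _).1 h
  refine (isWeaklyRegular_pair_iff _ _).2 ⟨fun x hx => ?_, fun x hx => ?_⟩
  · rw [← map_eq_zero_iff Φ Φ.injective]
    exact h₀ _ (by rw [← map_mul, hx, map_zero])
  · rw [← map_dvd_iff Φ] at hx ⊢
    rw [map_mul] at hx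
    exact h₁ _ hx

/-! ### Constant matrices times generic matrices -/

variable {k : ℕ}

/-- The product of the constant matrix `T` and the generic `k × n` matrix. -/
noncomputable def mulGeneric (T : Matrix (Fin (n + 1)) (Fin k) A) :
    Matrix (Fin (n + 1)) (Fin n) (MvPolynomial (Fin k × Fin n) A) :=
  Matrix.of fun l j => ∑ i, C (T l i) * X (i, j)

/-- Since the columns S of T form the identity, entry (l, j) of the product is Z(S l, j) plus a
linear form in the variables with row index outside S. Moving the latter variables into the
coefficient ring reduces to the shifted generic matrix. -/
theorem isWeaklyRegular_mulGeneric [Nontrivial A] (hn : 0 < n) (T : Matrix (Fin (n + 1)) (Fin k) A)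
    (S : Fin (n + 1) → Fin k) (hT : ∀ l l', T l (S l') = if l = l' then 1 else 0) :
    IsWeaklyRegular (MvPolynomial (Fin k × Fin n) A)
      [((mulGeneric T).submatrix Fin.castSucc id).det,
        ((mulGeneric T).submatrix Fin.succ id).det] := by
  classical
  have hS : Function.Injective S := fun l l' h => by
    by_contra hne
    have h₁ := hT l l
    rw [h, hT l l', if_neg hne, if_pos rfl] at h₁
    exact zero_ne_one h₁
  let ε : Fin (n + 1) ⊕ ((Set.range S)ᶜ : Set (Fin k)) ≃ Fin k :=
    (Equiv.sumCongr (Equiv.ofInjective S hS) (Equiv.refl _)).trans (Equiv.Set.sumCompl _)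
  have hε₁ : ∀ l, ε (Sum.inl l) = S l := fun l => rfl
  let ε' : Fin k × Fin n ≃ (Fin (n + 1) ×ₗ Fin n) ⊕ ((Set.range S)ᶜ : Set (Fin k)) × Fin n :=
    (Equiv.prodCongr ε.symm (Equiv.refl _)).trans ((Equiv.sumProdDistrib _ _ _).trans
      (Equiv.sumCongr toLex (Equiv.refl _)))
  let Φ := (renameEquiv A ε').trans
    (sumAlgEquiv A (Fin (n + 1) ×ₗ Fin n) (((Set.range S)ᶜ : Set (Fin k)) × Fin n))
  have hΦ₁ : ∀ l j, Φ (X (ε (Sum.inl l), j)) = X (toLex (l, j)) := fun l j => by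
    simp [Φ, ε']
  have hΦ₂ : ∀ i j, Φ (X (ε (Sum.inr i), j)) = C (X (i, j)) := fun i j => by
    simp [Φ, ε']
  have hΦC : ∀ x, Φ (C x) = C (C x) := fun x => by simp [Φ]
  let c : Fin (n + 1) → Fin n → MvPolynomial (((Set.range S)ᶜ : Set (Fin k)) × Fin n) A :=
    fun l j => ∑ i, C (T l (ε (Sum.inr i))) * X (i, j)
  have hW : (mulGeneric T).map Φ = shiftedGeneric c := by
    ext1 l j
    simp only [Matrix.map_apply, mulGeneric, shiftedGeneric, Matrix.of_apply, c]
    rw [map_sum, ← ε.sum_comp, Fintype.sum_sum_type, map_sum]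
    congr 1
    · simp only [map_mul, hΦ₁, hΦC]
      simp only [hε₁, hT]
      rw [Finset.sum_eq_single l]
      · simp
      · intro b _ hb
        simp [hb.symm]
      · simp
    · simp only [map_mul, hΦ₂, hΦC]
  have hdet : ∀ r : Fin n → Fin (n + 1), Φ.toRingEquiv ((mulGeneric T).submatrix r id).det =
      ((shiftedGeneric c).submatrix r id).det := fun r => by
    rw [← hW]
    exact Φ.map_det _
  refine isWeaklyRegular_pair_of_ringEquiv Φ.toRingEquiv ?_
  rw [hdet, hdet]
  exact isWeaklyRegular_shiftedGeneric hn c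

/-- Over a flat algebra over the ring of the generic entries, a vector `f` whose image under a
generic matrix is divisible by a nonzerodivisor `s` is itself divisible by `s`. -/
theorem dvd_of_mulGeneric [Nontrivial A] {B : Type*} [CommRing B] [Algebra (MvPolynomial (Fin k × Fin n) A) B]
    [Module.Flat (MvPolynomial (Fin k × Fin n) A) B]
    (T : Matrix (Fin (n + 1)) (Fin k) A)
    (S : Fin (n + 1) → Fin k) (hT : ∀ l l', T l (S l') = if l = l' then 1 else 0)
    {s : B} (hs : ∀ x, s * x = 0 → x = 0) (f : Fin n → B)
    (hf : ∀ l, s ∣ ∑ j, algebraMap _ B (mulGeneric T l j) * f j) (j : Fin n) : s ∣ f j := by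
  have key : ∀ r : Fin n → Fin (n + 1),
      s ∣ algebraMap _ B ((mulGeneric T).submatrix r id).det * f j := fun r => by
    let M := ((mulGeneric T).submatrix r id).map (algebraMap (MvPolynomial (Fin k × Fin n) A) B)
    have hM : (algebraMap (MvPolynomial (Fin k × Fin n) A) B)
        ((mulGeneric T).submatrix r id).det = M.det := RingHom.map_det _ _
    have h : M.adjugate.mulVec (M.mulVec f) j = M.det * f j := by
      rw [Matrix.mulVec_mulVec, Matrix.adjugate_mul, Matrix.smul_mulVec, Matrix.one_mulVec]
      rfl
    rw [hM, ← h]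
    change s ∣ ∑ i, M.adjugate j i *
      ∑ j', algebraMap (MvPolynomial (Fin k × Fin n) A) B (mulGeneric T (r i) j') * f j'
    exact Finset.dvd_sum fun i _ => Dvd.dvd.mul_left (hf (r i)) _
  exact dvd_of_pair (isWeaklyRegular_mulGeneric (Fin.pos j) T S hT).of_flat hs (key _) (key _)

end GenericMinors

/-! ### Modules of constant rank -/

section Rank

variable {R : Type*} [CommRing R] {M : Type*} [AddCommGroup M] [Module R M]

theorem IsFreeOfRankOver.baseChange {Q C : Type*} [CommRing Q] [Algebra R Q] [CommRing C]
    [Algebra R C] [Algebra Q C] [IsScalarTower R Q C] {e : ℕ} (h : IsFreeOfRankOver R M Q e) :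
    IsFreeOfRankOver R M C e := by
  obtain ⟨φ⟩ := h
  exact ⟨(TensorProduct.AlgebraTensorModule.cancelBaseChange R Q C C M).symm ≪≫ₗ
    TensorProduct.AlgebraTensorModule.congr (LinearEquiv.refl C C) φ ≪≫ₗ
      TensorProduct.piScalarRight Q C C (Fin e)⟩

theorem IsFreeOfRankOver.tensorProduct {A C : Type*} [CommRing A] [Algebra R A] [CommRing C]
    [Algebra R C] [Algebra A C] [IsScalarTower R A C] {e : ℕ} (h : IsFreeOfRankOver R M C e) :
    IsFreeOfRankOver A (A ⊗[R] M) C e := by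
  obtain ⟨φ⟩ := h
  exact ⟨TensorProduct.AlgebraTensorModule.cancelBaseChange R A C C M ≪≫ₗ φ⟩

/-- Over C the v_i define a surjective endomorphism of C^e, which is injective; relations over R are
detected in C. -/
theorem linearIndependent_of_span_eq_top {C : Type*} [CommRing C] [Algebra R C]
    (hinj : Function.Injective (algebraMap R C)) {e : ℕ} (h : IsFreeOfRankOver R M C e)
    (v : Fin e → M) (hv : Submodule.span C (Set.range fun i => (1 : C) ⊗ₜ[R] v i) = ⊤) :
    LinearIndependent R v := by
  obtain ⟨φ⟩ := h
  let L := Fintype.linearCombination C (fun i => (1 : C) ⊗ₜ[R] v i)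
  have hL : Function.Surjective L := by
    rw [← LinearMap.range_eq_top, Fintype.range_linearCombination, hv]
  have hL' : Function.Injective (φ.toLinearMap ∘ₗ L) :=
    OrzechProperty.injective_of_surjective_endomorphism _ (by
      simpa using φ.surjective.comp hL)
  rw [Fintype.linearIndependent_iff]
  intro g hg i
  have : (φ.toLinearMap ∘ₗ L) (fun i => algebraMap R C (g i)) = 0 := by
    have h₁ : L (fun i => algebraMap R C (g i)) = (1 : C) ⊗ₜ[R] ∑ i, g i • v i := by
      rw [Fintype.linearCombination_apply, TensorProduct.tmul_sum]
      exact Finset.sum_congr rfl fun i _ => by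
        rw [TensorProduct.tmul_smul, algebraMap_smul]
    rw [LinearMap.comp_apply, h₁, hg, TensorProduct.tmul_zero, map_zero]
  have h₂ := congrFun (hL' (this.trans (map_zero _).symm)) i
  exact hinj (h₂.trans (map_zero _).symm)

/-- If `M` has rank `e` over `R` and `A` is flat over `R`, then `A ⊗ M` becomes free of rank `e`
over the total ring of fractions of `A ⊗ Q`, with `Q` that of `R`. -/
theorem isFreeOfRankOver_of_flat {e : ℕ} (h : HasRank R M e) (A : Type*) [CommRing A]
    [Algebra R A] [Module.Flat R A] :
    IsFreeOfRankOver A (A ⊗[R] M) (FractionRing (A ⊗[R] FractionRing R)) e := by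
  let _ : Algebra (FractionRing R) (A ⊗[R] FractionRing R) := Algebra.TensorProduct.rightAlgebra
  have : IsScalarTower R (FractionRing R) (A ⊗[R] FractionRing R) :=
    Algebra.TensorProduct.right_isScalarTower
  exact (h.baseChange (C := FractionRing (A ⊗[R] FractionRing R))).tensorProduct

/-- The ring A ⊗ Q is a Q-algebra and flat over A, so a stays a nonzerodivisor in it and becomes a
unit in its total ring of fractions. There the v_i generate a free module of rank e. -/
theorem linearIndependent_of_smul_mem_span {e : ℕ} (h : HasRank R M e) {A : Type*} [CommRing A]
    [Algebra R A] [Module.Flat R A] (v : Fin e → A ⊗[R] M) {a : A} (ha : ∀ x, a * x = 0 → x = 0)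
    (hv : ∀ m, a • m ∈ Submodule.span A (Set.range v)) : LinearIndependent A v := by
  have hflat : Module.Flat A (A ⊗[R] FractionRing R) := inferInstance
  have hinj₁ : Function.Injective (algebraMap A (A ⊗[R] FractionRing R)) :=
    Algebra.TensorProduct.includeLeft_injective (S := A) (IsFractionRing.injective R _)
  have hinj : Function.Injective (algebraMap A (FractionRing (A ⊗[R] FractionRing R))) := by
    rw [IsScalarTower.algebraMap_eq A (A ⊗[R] FractionRing R)]
    exact (IsFractionRing.injective (A ⊗[R] FractionRing R) _).comp hinj₁
  have hreg : IsSMulRegular A a :=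
    isSMulRegular_iff_right_eq_zero_of_smul.2 ha
  have hunit : IsUnit (algebraMap A (FractionRing (A ⊗[R] FractionRing R)) a) := by
    rw [IsScalarTower.algebraMap_apply A (A ⊗[R] FractionRing R)]
    refine IsLocalization.map_units _ (⟨_, ?_⟩ : nonZeroDivisors (A ⊗[R] FractionRing R))
    have := hreg.of_flat (S := A ⊗[R] FractionRing R)
    rw [mem_nonZeroDivisors_iff_right]
    intro x hx
    exact isSMulRegular_iff_right_eq_zero_of_smul.1 this x
      (by rwa [smul_eq_mul, mul_comm])
  refine linearIndependent_of_span_eq_top hinj (isFreeOfRankOver_of_flat h A) v ?_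
  set C := FractionRing (A ⊗[R] FractionRing R)
  have hmem : ∀ m ∈ Submodule.span A (Set.range v),
      (1 : C) ⊗ₜ[A] m ∈ Submodule.span C (Set.range fun i => (1 : C) ⊗ₜ[A] v i) := by
    intro m hm
    induction hm using Submodule.span_induction with
    | mem x hx =>
      obtain ⟨i, rfl⟩ := hx
      exact Submodule.subset_span ⟨i, rfl⟩
    | zero => simp
    | add x y _ _ hx hy => rw [TensorProduct.tmul_add]; exact add_mem hx hy
    | smul c x _ hx =>
      rw [TensorProduct.tmul_smul, ← algebraMap_smul C c]
      exact Submodule.smul_mem _ _ hx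
  refine eq_top_iff.2 fun z _ => ?_
  induction z with
  | zero => exact zero_mem _
  | add x y hx hy => exact add_mem (hx trivial) (hy trivial)
  | tmul c m =>
    obtain ⟨u, hu⟩ := hunit
    have h₁ := hmem _ (hv m)
    have h₂ : c ⊗ₜ[A] m = (c * ↑u⁻¹) • ((1 : C) ⊗ₜ[A] (a • m)) := by
      rw [TensorProduct.tmul_smul, ← algebraMap_smul C a, ← hu, smul_smul, mul_assoc,
        Units.inv_mul, mul_one, TensorProduct.smul_tmul', smul_eq_mul, mul_one]
    rw [h₂]
    exact Submodule.smul_mem _ _ h₁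

end Rank

/-! ### Localization at primes not containing the Fitting ideal -/

section LocallyFree

variable {R : Type*} [CommRing R] {E : Type*} [AddCommGroup E] [Module R E]

/-- A minor of size n - e outside q becomes invertible, so its adjugate eliminates the n - e
generators indexed by its rows. -/
theorem exists_generators_of_not_fittingIdeal_le {e : ℕ} {q : Ideal R} [q.IsPrime]
    (hq : ¬ fittingIdeal R E e ≤ q) :
    ∃ v : Fin e → Localization.AtPrime q ⊗[R] E,
      Submodule.span (Localization.AtPrime q) (Set.range v) = ⊤ := by
  classical
  obtain ⟨n, m, A, x, hA, r, c, hdet⟩ : ∃ (n m : ℕ) (A : Matrix (Fin n) (Fin m) R)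
      (x : Fin n → E) (_ : IsPresentation A x) (r : Fin (n - e) → Fin n)
      (c : Fin (n - e) → Fin m), (A.submatrix r c).det ∉ q := by
    by_contra! hcon
    refine hq (iSup_le fun n => iSup_le fun m => iSup_le fun A => iSup_le fun x =>
      iSup_le fun hA => Ideal.span_le.2 ?_)
    rintro _ ⟨⟨r, c⟩, rfl⟩
    exact hcon n m A x hA r c
  have hr : Function.Injective r := by
    intro i j hij
    by_contra hne
    refine hdet ?_
    rw [Matrix.det_zero_of_row_eq hne (by ext; simp [hij])]
    exact zero_mem _
  set Rq := Localization.AtPrime q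
  let K := ((Set.range r)ᶜ : Set (Fin n))
  let N := Submodule.span Rq (Set.range fun i : K => (1 : Rq) ⊗ₜ[R] x i)
  have hrel : ∀ j, ∑ i, A i j • x i = 0 := fun j => by
    have : A.mulVecLin (Pi.single j 1) ∈ LinearMap.ker (Fintype.linearCombination R x) :=
      hA.2 ▸ ⟨_, rfl⟩
    simpa [Fintype.linearCombination_apply] using this
  let ν : E →ₗ[R] (Rq ⊗[R] E) ⧸ N := (N.mkQ.restrictScalars R) ∘ₗ TensorProduct.mk R Rq E 1
  have hν : ∀ y, ν y = 0 ↔ (1 : Rq) ⊗ₜ[R] y ∈ N := fun y => Submodule.Quotient.mk_eq_zero N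
  have hzK : ∀ i ∉ Set.range r, ν (x i) = 0 := fun i hi =>
    (hν _).2 (Submodule.subset_span ⟨⟨i, hi⟩, rfl⟩)
  have hzrel : ∀ j, ∑ a, A (r a) (c j) • ν (x (r a)) = 0 := fun j => by
    have := congrArg ν (hrel (c j))
    rw [map_sum, map_zero] at this
    rw [← this]
    refine Fintype.sum_of_injective r hr _ _ (fun i hi => ?_) fun a => (map_smul ν _ _).symm
    rw [map_smul, hzK i hi, smul_zero]
  have hz : ∀ b, ν (x (r b)) = 0 := fun b => by
    have h₁ : ∑ a, (A.submatrix r c * (A.submatrix r c).adjugate) a b • ν (x (r a)) = 0 := by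
      simp only [Matrix.mul_apply, Finset.sum_smul]
      rw [Finset.sum_comm]
      refine Finset.sum_eq_zero fun j _ => ?_
      rw [← smul_zero ((A.submatrix r c).adjugate j b), ← hzrel j, Finset.smul_sum]
      exact Finset.sum_congr rfl fun a _ => by rw [smul_smul, mul_comm]; rfl
    rw [Matrix.mul_adjugate, Finset.sum_eq_single b] at h₁
    · rw [Matrix.smul_apply, Matrix.one_apply_eq, smul_eq_mul, mul_one,
        ← algebraMap_smul Rq] at h₁
      exact (IsLocalization.map_units Rq (⟨_, hdet⟩ : q.primeCompl)).smul_eq_zero.1 h₁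
    · intro a _ hab
      rw [Matrix.smul_apply, Matrix.one_apply_ne hab, smul_zero, zero_smul]
    · simp
  have hν₀ : ∀ y, ν y = 0 := fun y => by
    have hy : y ∈ Submodule.span R (Set.range x) := hA.1 ▸ Submodule.mem_top
    induction hy using Submodule.span_induction with
    | mem y hy =>
      obtain ⟨i, rfl⟩ := hy
      by_cases hi : i ∈ Set.range r
      · obtain ⟨b, rfl⟩ := hi
        exact hz b
      · exact hzK i hi
    | zero => exact map_zero ν
    | add y y' _ _ hy hy' => rw [map_add, hy, hy', add_zero]
    | smul t y _ hy => rw [map_smul, hy, smul_zero]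
  have hN : N = ⊤ := by
    refine eq_top_iff.2 fun w _ => ?_
    induction w with
    | zero => exact zero_mem _
    | add x y hx hy => exact add_mem (hx trivial) (hy trivial)
    | tmul t y =>
      rw [← mul_one t, ← smul_eq_mul, ← TensorProduct.smul_tmul']
      exact N.smul_mem _ ((hν y).1 (hν₀ y))
  -- There are n - (n - e) generators left, at most e even if the inner subtraction truncates; zeros
  -- pad them to e.
  have hcard : Fintype.card K ≤ Fintype.card (Fin e) := by
    rw [Fintype.card_compl_set, Set.card_range_of_injective hr]
    simp
    omega
  obtain ⟨ι⟩ := Function.Embedding.nonempty_of_card_le hcard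
  refine ⟨Function.extend ι (fun i : K => (1 : Rq) ⊗ₜ[R] x i) 0, ?_⟩
  rw [eq_top_iff, ← hN]
  refine Submodule.span_mono ?_
  rintro _ ⟨i, rfl⟩
  exact ⟨ι i, ι.injective.extend_apply _ _ _⟩

theorem exists_equiv_of_not_fittingIdeal_le {e : ℕ} (h : HasRank R E e) {q : Ideal R} [q.IsPrime]
    (hq : ¬ fittingIdeal R E e ≤ q) :
    Nonempty ((Localization.AtPrime q ⊗[R] E) ≃ₗ[Localization.AtPrime q]
      (Fin e → Localization.AtPrime q)) := by
  obtain ⟨v, hv⟩ := exists_generators_of_not_fittingIdeal_le hq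
  have : Module.Flat R (Localization.AtPrime q) := IsLocalization.flat _ q.primeCompl
  have hli := linearIndependent_of_smul_mem_span h v (a := 1) (by simp) (by simp [hv])
  exact ⟨(Module.Basis.mk hli hv.ge).equivFun⟩

/-- A reduction of `E` agrees with `E` at the primes at which `E` is free. -/
theorem span_residue_eq_top_of_isReduction {e : ℕ} {q : Ideal R} [q.IsPrime]
    (φ : (Localization.AtPrime q ⊗[R] E) ≃ₗ[Localization.AtPrime q]
      (Fin e → Localization.AtPrime q)) {U : Submodule R E} (hU : IsReduction U)
    {k : ℕ} {a : Fin k → E} (ha : Submodule.span R (Set.range a) = U) :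
    Submodule.span (IsLocalRing.ResidueField (Localization.AtPrime q))
      (Set.range fun (i : Fin k) (l : Fin e) =>
        IsLocalRing.residue (Localization.AtPrime q) (φ (1 ⊗ₜ a i) l)) = ⊤ := by
  set Rq := Localization.AtPrime q
  set κ := IsLocalRing.ResidueField Rq
  by_contra hne
  -- A nonzero linear form vanishing on the residues of the a_i will extend to a homomorphism from
  -- the Rees algebra to the residue field that kills U but not E.
  obtain ⟨f, hf₀, hf⟩ := Submodule.exists_le_ker_of_lt_top _ (lt_top_iff_ne_top.2 hne)
  have : Module.Flat R Rq := IsLocalization.flat _ q.primeCompl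
  have : Module.Flat R (MvPolynomial (Fin e) Rq) := Module.Flat.trans R Rq _
  let lam : E →ₗ[R] (Fin e → Rq) :=
    (φ.toLinearMap.restrictScalars R) ∘ₗ TensorProduct.mk R Rq E 1
  let G : E →ₗ[R] MvPolynomial (Fin e) Rq :=
    ((Fintype.linearCombination Rq
      (MvPolynomial.X : Fin e → MvPolynomial (Fin e) Rq)).restrictScalars R) ∘ₗ lam
  -- The torsion maps to zero because the polynomial ring is flat over R.
  let Ψ₁ : ReesAlgebra R E →ₐ[R] MvPolynomial (Fin e) Rq :=
    Ideal.Quotient.liftₐ _ (SymmetricAlgebra.lift G) (fun x hx => by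
      obtain ⟨r, hr⟩ := (Submodule.mem_torsion_iff x).1 hx
      have hr' : (r : R) • x = 0 := hr
      have hreg : IsSMulRegular R (r : R) :=
        isSMulRegular_iff_right_eq_zero_of_smul.2 fun y hy =>
          (mul_left_mem_nonZeroDivisors_eq_zero_iff r.2).1 hy
      have := hreg.of_flat (S := MvPolynomial (Fin e) Rq)
      refine isSMulRegular_iff_right_eq_zero_of_smul.1 this _ ?_
      rw [algebraMap_smul, ← map_smul, hr', map_zero])
  let Ψ : ReesAlgebra R E →ₐ[R] κ :=
    ((MvPolynomial.aeval (fun l => f (Pi.single l 1)) :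
      MvPolynomial (Fin e) Rq →ₐ[Rq] κ).restrictScalars R).comp Ψ₁
  have hΨ : ∀ x, Ψ (toRees R E x) = f (fun l => IsLocalRing.residue Rq (lam x l)) := fun x => by
    have h₁ : Ψ₁ (toRees R E x) = G x := SymmetricAlgebra.lift_ι_apply G x
    change MvPolynomial.aeval (fun l => f (Pi.single l 1)) (Ψ₁ (toRees R E x)) = _
    rw [h₁, LinearMap.pi_apply_eq_sum_univ f]
    simp only [G, LinearMap.comp_apply, LinearMap.restrictScalars_apply,
      Fintype.linearCombination_apply, map_sum, map_smul, MvPolynomial.aeval_X]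
    refine Finset.sum_congr rfl fun i _ => ?_
    have h₂ : (fun j => if i = j then (1 : κ) else 0) = Pi.single i 1 := by
      ext j
      simp [Pi.single_apply, eq_comm]
    rw [h₂]
    rfl
  have hΨU : ∀ u ∈ U.map (toRees R E), Ψ u = 0 := by
    rintro _ ⟨x, hx, rfl⟩
    rw [SetLike.mem_coe, ← ha] at hx
    induction hx using Submodule.span_induction with
    | mem x hx =>
      obtain ⟨i, rfl⟩ := hx
      rw [hΨ]
      exact hf (Submodule.subset_span ⟨i, rfl⟩)
    | zero => simp
    | add x y _ _ hx hy => rw [map_add, map_add, hx, hy, add_zero]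
    | smul c x _ hx => rw [map_smul, map_smul, hx, smul_zero]
  obtain ⟨x, hx⟩ : ∃ x, Ψ (toRees R E x) ≠ 0 := by
    by_contra! hcon
    refine hf₀ (LinearMap.ext fun w => ?_)
    have key : ∀ z, f (fun l => IsLocalRing.residue Rq (φ z l)) = 0 := fun z => by
      induction z with
      | zero => simp; exact map_zero f
      | add x y hx hy =>
        simp only [map_add, Pi.add_apply]
        exact (map_add f _ _).trans (by rw [hx, hy, add_zero])
      | tmul c x =>
        have h₁ : c ⊗ₜ[R] x = c • ((1 : Rq) ⊗ₜ[R] x) := by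
          rw [TensorProduct.smul_tmul', smul_eq_mul, mul_one]
        have h₂ := hcon x
        rw [hΨ] at h₂
        rw [h₁, map_smul]
        have h₃ : (fun l => IsLocalRing.residue Rq ((c • φ ((1 : Rq) ⊗ₜ[R] x)) l)) =
            IsLocalRing.residue Rq c • fun l => IsLocalRing.residue Rq (lam x l) := by
          ext l
          simp [lam]
        rw [h₃, map_smul, h₂, smul_zero]
    choose w' hw' using fun l => IsLocalRing.residue_surjective (w l)
    have := key (φ.symm w')
    rw [LinearEquiv.apply_symm_apply] at this
    exact (congrArg f (funext hw')).symm.trans this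
  obtain ⟨r, hr⟩ := hU
  -- The reduction equation forces the (r + 1)-st power of a nonzero element of the residue field to
  -- vanish.
  have hmem : toRees R E x ^ (r + 1) ∈ U.map (toRees R E) * reesPiece R E r := by
    rw [← hr]
    exact Submodule.pow_mem_pow _ (LinearMap.mem_range_self _ x) _
  have hzero : ∀ z ∈ U.map (toRees R E) * reesPiece R E r, Ψ z = 0 := fun z hz => by
    induction hz using Submodule.mul_induction_on' with
    | mem_mul_mem u hu v _ => rw [map_mul, hΨU u hu, zero_mul]
    | add x _ y _ hx hy => rw [map_add, hx, hy, add_zero]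
  have := hzero _ hmem
  rw [map_pow] at this
  exact hx (pow_eq_zero_iff (Nat.succ_ne_zero r) |>.1 this)

/-- Among the residues of the a_i there is a basis. Its coordinate matrix P over the local ring is
invertible, and P⁻¹ turns the chosen a_i into the standard basis. -/
theorem exists_dual_of_not_fittingIdeal_le {e : ℕ} (h : HasRank R E e)
    {U : Submodule R E} (hU : IsReduction U)
    {k : ℕ} {a : Fin k → E} (ha : Submodule.span R (Set.range a) = U) {q : Ideal R} [q.IsPrime]
    (hq : ¬ fittingIdeal R E e ≤ q) :
    ∃ (S : Fin e → Fin k) (lam : E →ₗ[R] (Fin e → Localization.AtPrime q)),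
      ∀ l l', lam (a (S l')) l = if l = l' then 1 else 0 := by
  obtain ⟨φ⟩ := exists_equiv_of_not_fittingIdeal_le h hq
  have hspan := span_residue_eq_top_of_isReduction φ hU ha
  set Rq := Localization.AtPrime q
  set κ := IsLocalRing.ResidueField Rq
  let lam : E →ₗ[R] (Fin e → Rq) :=
    (φ.toLinearMap.restrictScalars R) ∘ₗ TensorProduct.mk R Rq E 1
  set b : Fin k → Fin e → κ := fun i l => IsLocalRing.residue Rq (φ (1 ⊗ₜ a i) l) with hb
  obtain ⟨T, s, -, hs, hli⟩ := exists_linearIndependent' κ b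
  rw [hspan] at hs
  let B := Module.Basis.mk hli hs.ge
  have : Fintype T := FiniteDimensional.fintypeBasisIndex B
  have hcard : Fintype.card T = Fintype.card (Fin e) := by
    rw [← Module.finrank_eq_card_basis B]; simp
  let ε : Fin e ≃ T := (Fintype.equivOfCardEq hcard).symm
  let P : Matrix (Fin e) (Fin e) Rq := Matrix.of fun l l' => lam (a (s (ε l'))) l
  have hP : IsUnit P.det := by
    rw [← IsLocalRing.residue_ne_zero_iff_isUnit, RingHom.map_det, ← isUnit_iff_ne_zero,
      ← Matrix.isUnit_iff_isUnit_det, ← Matrix.linearIndependent_cols_iff_isUnit]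
    exact hli.comp ε ε.injective
  refine ⟨s ∘ ε, ((P⁻¹).mulVecLin.restrictScalars R) ∘ₗ lam, fun l l' => ?_⟩
  have h₁ : lam (a (s (ε l'))) = P.col l' := rfl
  change (P⁻¹).mulVec (lam (a (s (ε l')))) l = _
  rw [h₁, ← Matrix.mulVec_single_one, Matrix.mulVec_mulVec, Matrix.nonsing_inv_mul _ hP,
    Matrix.one_mulVec, Pi.single_apply]

end LocallyFree

/-! ### The quotient by the generic elements is torsion-free -/

section TorsionFree

/-- Torsion-freeness embeds E into Q^e, so A ⊗ E embeds into A ⊗ Q^e, which is flat over A. -/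
theorem eq_zero_of_smul_baseChange {R : Type*} [CommRing R] {E : Type*} [AddCommGroup E]
    [Module R E] [Module.IsTorsionFree R E] {e : ℕ} (h : HasRank R E e) {A : Type*} [CommRing A]
    [Algebra R A] [Module.Flat R A] {s : A} (hs : ∀ x, s * x = 0 → x = 0) (u : A ⊗[R] E)
    (hu : s • u = 0) : u = 0 := by
  obtain ⟨φ⟩ := h
  have : Module.Flat R (FractionRing R) := IsLocalization.flat _ (nonZeroDivisors R)
  have : Module.Flat R (Fin e → FractionRing R) := Module.Flat.trans R (FractionRing R) _
  let j : E →ₗ[R] (Fin e → FractionRing R) :=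
    (φ.toLinearMap.restrictScalars R) ∘ₗ TensorProduct.mk R (FractionRing R) E 1
  have hj : Function.Injective j := by
    refine φ.injective.comp ((injective_iff_map_eq_zero _).2 fun x hx => ?_)
    obtain ⟨c, hc⟩ := (IsLocalizedModule.eq_zero_iff (nonZeroDivisors R) _).1 hx
    have hc' : IsRegular (c : R) := le_nonZeroDivisors_iff_isRegular.mp le_rfl c
    exact isSMulRegular_iff_right_eq_zero_of_smul.1 (hc'.isSMulRegular (M := E)) x hc
  have hj' : Function.Injective (j.baseChange A) :=
    Module.Flat.lTensor_preserves_injective_linearMap j hj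
  have hs' : IsRegular s := by
    have : IsLeftRegular s := fun x y hxy =>
      sub_eq_zero.1 (hs _ (by rw [mul_sub]; exact sub_eq_zero.2 hxy))
    exact isLeftRegular_iff_isRegular.1 this
  have hreg : IsSMulRegular (A ⊗[R] (Fin e → FractionRing R)) s :=
    Module.Flat.isSMulRegular_of_isRegular hs'
  refine hj' ?_
  rw [map_zero]
  refine isSMulRegular_iff_right_eq_zero_of_smul.1 hreg _ ?_
  rw [← map_smul, hu, map_zero]

variable {R : Type*} [CommRing R]

/-- The localization B of A at R ∖ q is flat over R[Z], hence over its localization Rq[Z], so the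
generic minors stay weakly regular in B. Clearing denominators in the divisibility over B costs the
factor r. -/
theorem exists_dvd_of_localization {k n : ℕ} {q : Ideal R} [q.IsPrime] {A : Type*} [CommRing A]
    [Algebra R A] [Algebra (MvPolynomial (Fin k × Fin n) R) A]
    [IsScalarTower R (MvPolynomial (Fin k × Fin n) R) A]
    [Module.Flat (MvPolynomial (Fin k × Fin n) R) A]
    {Rq : Type*} [CommRing Rq] [Algebra R Rq] [IsLocalization.AtPrime Rq q] [Nontrivial Rq]
    {B : Type*} [CommRing B] [Algebra A B] [Algebra R B] [IsScalarTower R A B]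
    [IsLocalization (Algebra.algebraMapSubmonoid A q.primeCompl) B]
    (g : Rq →ₐ[R] B) (T : Matrix (Fin (n + 1)) (Fin k) Rq)
    (S : Fin (n + 1) → Fin k) (hT : ∀ l l', T l (S l') = if l = l' then 1 else 0)
    {s : A} (hs : ∀ x, s * x = 0 → x = 0) (f : Fin n → A)
    (hf : ∀ l, algebraMap A B s ∣ ∑ j, (∑ i, g (T l i) * algebraMap A B
      (algebraMap (MvPolynomial (Fin k × Fin n) R) A (MvPolynomial.X (i, j)))) *
        algebraMap A B (f j)) (j : Fin n) :
    ∃ r ∉ q, s ∣ algebraMap R A r * f j := by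
  let M := Algebra.algebraMapSubmonoid A q.primeCompl
  let G : MvPolynomial (Fin k × Fin n) Rq →+* B :=
    MvPolynomial.eval₂Hom (g : Rq →+* B) fun z => algebraMap A B
      (algebraMap (MvPolynomial (Fin k × Fin n) R) A (MvPolynomial.X z))
  let _ : Algebra (MvPolynomial (Fin k × Fin n) Rq) B := G.toAlgebra
  let _ : Algebra (MvPolynomial (Fin k × Fin n) R) B :=
    ((algebraMap A B).comp (algebraMap (MvPolynomial (Fin k × Fin n) R) A)).toAlgebra
  have htower₁ : IsScalarTower (MvPolynomial (Fin k × Fin n) R) A B :=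
    IsScalarTower.of_algebraMap_eq' rfl
  let _ : Algebra (MvPolynomial (Fin k × Fin n) R) (MvPolynomial (Fin k × Fin n) Rq) :=
    MvPolynomial.algebraMvPolynomial
  have htower₂ : IsScalarTower (MvPolynomial (Fin k × Fin n) R) (MvPolynomial (Fin k × Fin n) Rq)
      B := by
    refine IsScalarTower.of_algebraMap_eq' (MvPolynomial.ringHom_ext (fun r => ?_) fun z => ?_)
    · rw [IsScalarTower.algebraMap_apply (MvPolynomial (Fin k × Fin n) R) A B,
        ← MvPolynomial.algebraMap_eq, ← IsScalarTower.algebraMap_apply R _ A,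
        ← IsScalarTower.algebraMap_apply R A B]
      change _ = G (MvPolynomial.map (algebraMap R Rq) _)
      simp [G]
    · rw [IsScalarTower.algebraMap_apply (MvPolynomial (Fin k × Fin n) R) A B]
      change _ = G (MvPolynomial.map (algebraMap R Rq) _)
      simp [G]
  have hflatB : Module.Flat A B := IsLocalization.flat B M
  have hflat' : Module.Flat (MvPolynomial (Fin k × Fin n) R) B := Module.Flat.trans _ A B
  have hflat : Module.Flat (MvPolynomial (Fin k × Fin n) Rq) B :=
    (Module.flat_iff_of_isLocalization (MvPolynomial (Fin k × Fin n) Rq)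
      (q.primeCompl.map (MvPolynomial.C (σ := Fin k × Fin n))) B).2 inferInstance
  have hsB : ∀ x, algebraMap A B s * x = 0 → x = 0 := by
    have hs' : IsSMulRegular A s := isSMulRegular_iff_right_eq_zero_of_smul.2 hs
    exact isSMulRegular_iff_right_eq_zero_of_smul.1 (hs'.of_flat (S := B))
  have hdvd : algebraMap A B s ∣ algebraMap A B (f j) := by
    refine dvd_of_mulGeneric T S hT hsB (fun j => algebraMap A B (f j)) (fun l => ?_) j
    convert hf l using 3 with j
    change G _ = _
    simp [G, mulGeneric]
  obtain ⟨b, hb⟩ := hdvd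
  obtain ⟨⟨b', t⟩, hbt⟩ := IsLocalization.surj M b
  obtain ⟨r, hr, hrt⟩ := t.2
  have h₁ : algebraMap A B (t * f j) = algebraMap A B (s * b') := by
    rw [map_mul, map_mul, ← hbt, hb]
    ring
  obtain ⟨t', ht'⟩ := (IsLocalization.eq_iff_exists M B).1 h₁
  obtain ⟨r', hr', hrt'⟩ := t'.2
  refine ⟨r' * r, fun h => ?_, algebraMap R A r' * b', ?_⟩
  · exact (Ideal.IsPrime.mem_or_mem inferInstance h).elim hr' hr
  · rw [← hrt, ← hrt'] at ht'
    rw [map_mul, mul_assoc]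
    exact ht'.trans (by ring)

variable [IsLocalRing R]

instance flat_nagata (σ : Type*) : Module.Flat R (Nagata R σ) :=
  have : Module.Flat (MvPolynomial σ R) (Nagata R σ) :=
    IsLocalization.flat _ (extendedMaximalIdeal R σ).primeCompl
  Module.Flat.trans R (MvPolynomial σ R) _

variable {E : Type*} [AddCommGroup E] [Module R E]

/-- It suffices to divide the coefficients f_j of s u by s: the difference between u and the
resulting element of F is killed by s, hence zero. -/
theorem mem_genericSubmodule_of_smul_mem {l : ℕ} (hrank : HasRank R E (l + 1))
    [Module.IsTorsionFree R E] {U : Submodule R E} (hU : IsReduction U)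
    {k : ℕ} {a : Fin k → E} (ha : Submodule.span R (Set.range a) = U)
    (hgrade : 2 ≤ grade (fittingIdeal R E (l + 1))) {s : Nagata R (Fin k × Fin l)}
    (hs : ∀ x, s * x = 0 → x = 0) {u : Nagata R (Fin k × Fin l) ⊗[R] E}
    (hu : s • u ∈ genericSubmodule R a l) : u ∈ genericSubmodule R a l := by
  let A := Nagata R (Fin k × Fin l)
  have hflat : Module.Flat (MvPolynomial (Fin k × Fin l) R) A :=
    IsLocalization.flat _ (extendedMaximalIdeal R (Fin k × Fin l)).primeCompl
  obtain ⟨f, hf⟩ := (Submodule.mem_span_range_iff_exists_fun A).1 hu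
  have hdvd : ∀ j, s ∣ f j := by
    intro j
    -- The multipliers r in R that make s divide r f_j. A prime over C not containing the Fitting
    -- ideal is excluded by the local case.
    let C : Ideal R :=
      { carrier := {r | s ∣ algebraMap R A r * f j}
        add_mem' := fun {x y} hx hy => by
          simpa only [Set.mem_ofPred_eq, map_add, add_mul] using dvd_add hx hy
        zero_mem' := by simp
        smul_mem' := fun c x hx => by
          simpa only [Set.mem_ofPred_eq, smul_eq_mul, map_mul, mul_assoc] using
            Dvd.dvd.mul_left hx _ }
    have hC : fittingIdeal R E (l + 1) ≤ C.radical := by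
      rw [Ideal.radical_eq_sInf]
      refine le_sInf fun q ⟨hCq, hq⟩ => ?_
      by_contra hFq
      obtain ⟨S, lam, hlam⟩ := exists_dual_of_not_fittingIdeal_le hrank hU ha hFq
      let Rq := Localization.AtPrime q
      let M := Algebra.algebraMapSubmonoid A q.primeCompl
      let B := Localization M
      let g : Rq →ₐ[R] B := IsLocalization.liftAlgHom (M := q.primeCompl)
        (f := Algebra.ofId R B) fun r => by
          rw [Algebra.ofId_apply, IsScalarTower.algebraMap_apply R A B]
          exact IsLocalization.map_units B (⟨_, r, r.2, rfl⟩ : M)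
      let T : Matrix (Fin (l + 1)) (Fin k) Rq := Matrix.of fun l i => lam (a i) l
      obtain ⟨r, hr, hrf⟩ := exists_dvd_of_localization (q := q) g T S hlam hs f (fun i => by
        -- The i-th local coordinate on E''. Applied to s u = ∑ f_j x_j it shows that s divides row
        -- i of the generic matrix times f.
        let Λ : A ⊗[R] E →ₗ[A] B := LinearMap.liftBaseChange A
          (g.toLinearMap ∘ₗ LinearMap.proj (R := R) (φ := fun _ => Rq) i ∘ₗ lam)
        refine ⟨Λ u, ?_⟩
        have h₁ := congrArg Λ hf
        rw [map_sum, map_smul, Algebra.smul_def] at h₁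
        rw [← h₁]
        refine Finset.sum_congr rfl fun j _ => ?_
        rw [map_smul, Algebra.smul_def, mul_comm]
        congr 1
        rw [genericElement, map_sum]
        refine Finset.sum_congr rfl fun i' _ => ?_
        rw [LinearMap.liftBaseChange_tmul, Algebra.smul_def, mul_comm]
        rfl) j
      exact hr (hCq hrf)
    obtain ⟨b, hb, c, hc, hbc⟩ := exists_pair_of_two_le_grade hgrade
    obtain ⟨m, hm⟩ := hC hb
    obtain ⟨n, hn⟩ := hC hc
    exact dvd_of_pair (isWeaklyRegular_pow_pair hbc m n).of_flat hs hm hn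
  choose f' hf' using hdvd
  have h₀ : u - ∑ j, f' j • genericElement R a l j = 0 := by
    refine eq_zero_of_smul_baseChange hrank hs _ ?_
    rw [smul_sub, ← hf, Finset.smul_sum, sub_eq_zero]
    exact Finset.sum_congr rfl fun j _ => by rw [hf' j, mul_smul]
  rw [sub_eq_zero.1 h₀]
  exact Submodule.sum_mem _ fun j _ => Submodule.smul_mem _ _ (Submodule.subset_span ⟨j, rfl⟩)

end TorsionFree

/-! ### Presentations of the generic quotient -/

section GenericQuotient

open Matrix

theorem HasRank.congr {R : Type*} [CommRing R] {M N : Type*} [AddCommGroup M] [Module R M]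
    [AddCommGroup N] [Module R N] {e : ℕ} (h : HasRank R M e) (g : M ≃ₗ[R] N) :
    HasRank R N e := by
  obtain ⟨φ⟩ := h
  exact ⟨TensorProduct.AlgebraTensorModule.congr (LinearEquiv.refl _ _) g.symm ≪≫ₗ φ⟩

/-- Flatness embeds Q ⊗ I into Q, and b becomes a unit there. -/
theorem hasRank_one_of_mem {A : Type*} [CommRing A] {I : Ideal A} {b : A} (hbI : b ∈ I)
    (hb : ∀ x, b * x = 0 → x = 0) : HasRank A I 1 := by
  have : Module.Flat A (FractionRing A) := IsLocalization.flat _ (nonZeroDivisors A)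
  let f : FractionRing A ⊗[A] I →ₗ[FractionRing A] FractionRing A :=
    (TensorProduct.AlgebraTensorModule.rid A (FractionRing A) (FractionRing A)).toLinearMap ∘ₗ
      LinearMap.baseChange (FractionRing A) I.subtype
  have hinj : Function.Injective f :=
    (TensorProduct.AlgebraTensorModule.rid A _ _).injective.comp
      (Module.Flat.lTensor_preserves_injective_linearMap _ I.subtype_injective)
  have hunit : IsUnit (algebraMap A (FractionRing A) b) :=
    IsLocalization.map_units _ (⟨b, mem_nonZeroDivisors_iff_right.2
      fun x hx => hb x (by rwa [mul_comm])⟩ : nonZeroDivisors A)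
  have hsurj : Function.Surjective f := fun z => by
    obtain ⟨u, hu⟩ := hunit
    refine ⟨(z * ↑u⁻¹) ⊗ₜ ⟨b, hbI⟩, ?_⟩
    have : f ((z * ↑u⁻¹) ⊗ₜ ⟨b, hbI⟩) = b • (z * ↑u⁻¹) := by simp [f]
    rw [this, Algebra.smul_def, ← hu, mul_comm, mul_assoc, Units.inv_mul, mul_one]
  exact ⟨LinearEquiv.ofBijective f ⟨hinj, hsurj⟩ ≪≫ₗ (LinearEquiv.funUnique (Fin 1) _ _).symm⟩

variable {R : Type*} [CommRing R] [IsLocalRing R] {E : Type*} [AddCommGroup E] [Module R E]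
  {k l d m : ℕ} (a : Fin k → E) (y : Fin (d + 1) → Nagata R (Fin k × Fin l) ⊗[R] E)

theorem relations_genericQuotient
    (φ : Matrix (Fin l ⊕ Fin (d + 1)) (Fin m) (Nagata R (Fin k × Fin l)))
    (hφ : IsPresentation φ (Sum.elim (genericElement R a l) y)) (c : Fin d ↪ Fin m)
    (ψ : Matrix (Fin (d + 1)) (Fin d) (Nagata R (Fin k × Fin l)))
    (hψ : ψ = φ.submatrix Sum.inr c) :
    Submodule.span (Nagata R (Fin k × Fin l)) (Set.range fun i =>
      (Submodule.Quotient.mk (y i) : GenericQuotient R a l)) = ⊤ ∧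
    Fintype.linearCombination (Nagata R (Fin k × Fin l)) (fun i =>
      (Submodule.Quotient.mk (y i) : GenericQuotient R a l)) ∘ₗ ψ.mulVecLin = 0 := by
  let A := Nagata R (Fin k × Fin l)
  have hx : ∀ j, (genericSubmodule R a l).mkQ (genericElement R a l j) = 0 := fun j =>
    (Submodule.Quotient.mk_eq_zero _).2 (Submodule.subset_span ⟨j, rfl⟩)
  constructor
  · have h := congrArg (Submodule.map (genericSubmodule R a l).mkQ) hφ.1
    rw [Submodule.map_top, Submodule.range_mkQ, Submodule.map_span] at h
    rw [eq_top_iff, ← h, Submodule.span_le]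
    rintro _ ⟨_, ⟨j | i, rfl⟩, rfl⟩
    · exact (hx j).symm ▸ zero_mem _
    · exact Submodule.subset_span ⟨i, rfl⟩
  · refine LinearMap.pi_ext' fun j => LinearMap.ext_ring ?_
    have h : φ.mulVecLin (Pi.single (c j) 1) ∈
        LinearMap.ker (Fintype.linearCombination A (Sum.elim (genericElement R a l) y)) :=
      hφ.2 ▸ ⟨_, rfl⟩
    rw [LinearMap.mem_ker, mulVecLin_apply, mulVec_single_one, Fintype.linearCombination_apply,
      Fintype.sum_sum_type] at h
    have h' := congrArg (genericSubmodule R a l).mkQ h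
    simp only [Sum.elim_inl, Sum.elim_inr, map_add, map_sum, map_smul, hx, smul_zero,
      Finset.sum_const_zero, zero_add, map_zero] at h'
    rw [LinearMap.comp_apply, LinearMap.single_apply, LinearMap.comp_apply, mulVecLin_apply,
      mulVec_single_one, Fintype.linearCombination_apply, hψ]
    exact h'

/-! ### Cramer's rule in the generic quotient -/

variable (ψ : Matrix (Fin (d + 1)) (Fin d) (Nagata R (Fin k × Fin l)))

/-- If w represents the class of u, then θ(v) u and θ(w) ∑ v_i y_i agree modulo F. -/
theorem minorMap_smul_mem_span
    (hy : Submodule.span (Nagata R (Fin k × Fin l)) (Set.range fun i =>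
      (Submodule.Quotient.mk (y i) : GenericQuotient R a l)) = ⊤)
    (hrel : Fintype.linearCombination (Nagata R (Fin k × Fin l)) (fun i =>
      (Submodule.Quotient.mk (y i) : GenericQuotient R a l)) ∘ₗ ψ.mulVecLin = 0)
    (v : Fin (d + 1) → Nagata R (Fin k × Fin l))
    (u : Nagata R (Fin k × Fin l) ⊗[R] E) :
    minorMap ψ v • u ∈ Submodule.span (Nagata R (Fin k × Fin l)) (Set.range
      (Fin.cons (∑ i, v i • y i) (genericElement R a l) : Fin (l + 1) → _)) := by
  let A := Nagata R (Fin k × Fin l)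
  let L := Fintype.linearCombination A fun i =>
    (Submodule.Quotient.mk (y i) : GenericQuotient R a l)
  have hL : Function.Surjective L := by
    rw [← LinearMap.range_eq_top, Fintype.range_linearCombination, hy]
  obtain ⟨w, hw⟩ := hL (Submodule.Quotient.mk u)
  obtain ⟨t, ht⟩ := exists_minorMap_smul_add ψ w v
  have h := congrArg L ht
  have hLt : L (ψ *ᵥ t) = 0 := LinearMap.congr_fun hrel t
  have hLv : L v = Submodule.Quotient.mk (∑ i, v i • y i) := by
    change _ = (genericSubmodule R a l).mkQ _
    rw [map_sum]
    simp only [map_smul]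
    rfl
  rw [map_add, map_smul, map_smul, hLt, add_zero, hw, hLv, ← Submodule.Quotient.mk_smul,
    ← Submodule.Quotient.mk_smul, Submodule.Quotient.eq] at h
  rw [Fin.range_cons, Submodule.span_insert]
  exact Submodule.mem_sup.2 ⟨minorMap ψ w • ∑ i, v i • y i,
    Submodule.smul_mem _ _ (Submodule.mem_span_singleton_self _), _, h, by abel⟩

theorem linearIndependent_cons_genericElement
    (hy : Submodule.span (Nagata R (Fin k × Fin l)) (Set.range fun i =>
      (Submodule.Quotient.mk (y i) : GenericQuotient R a l)) = ⊤)
    (hrel : Fintype.linearCombination (Nagata R (Fin k × Fin l)) (fun i =>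
      (Submodule.Quotient.mk (y i) : GenericQuotient R a l)) ∘ₗ ψ.mulVecLin = 0)
    (hrank : HasRank R E (l + 1))
    {v : Fin (d + 1) → Nagata R (Fin k × Fin l)}
    (hv : ∀ x, minorMap ψ v * x = 0 → x = 0) :
    LinearIndependent (Nagata R (Fin k × Fin l))
      (Fin.cons (∑ i, v i • y i) (genericElement R a l) : Fin (l + 1) → _) :=
  linearIndependent_of_smul_mem_span hrank _ hv (minorMap_smul_mem_span a y ψ hy hrel v)

theorem linearIndependent_genericElement
    (hy : Submodule.span (Nagata R (Fin k × Fin l)) (Set.range fun i =>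
      (Submodule.Quotient.mk (y i) : GenericQuotient R a l)) = ⊤)
    (hrel : Fintype.linearCombination (Nagata R (Fin k × Fin l)) (fun i =>
      (Submodule.Quotient.mk (y i) : GenericQuotient R a l)) ∘ₗ ψ.mulVecLin = 0)
    (hrank : HasRank R E (l + 1))
    {b : Nagata R (Fin k × Fin l)} (hbI : b ∈ minorIdeal d ψ) (hb : ∀ x, b * x = 0 → x = 0) :
    LinearIndependent (Nagata R (Fin k × Fin l)) (genericElement R a l) ∧
      ∀ r : Nagata R (Fin k × Fin l),
        (∀ i, r • (Submodule.Quotient.mk (y i) : GenericQuotient R a l) = 0) → r = 0 := by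
  obtain ⟨v, rfl⟩ := exists_minorMap_eq ψ hbI
  have hli := linearIndependent_cons_genericElement a y ψ hy hrel hrank hb
  refine ⟨by simpa [Function.comp_def] using hli.comp Fin.succ (Fin.succ_injective _),
    fun r hr => ?_⟩
  -- A common annihilator r yields a relation between ∑ v_i y_i and the x_j with leading coefficient
  -- r, so r = 0 by independence.
  have hmem : r • ∑ i, v i • y i ∈ genericSubmodule R a l := by
    rw [Finset.smul_sum]
    refine Submodule.sum_mem _ fun i _ => ?_
    rw [smul_comm]
    refine Submodule.smul_mem _ _ ?_
    rw [← Submodule.Quotient.mk_eq_zero, Submodule.Quotient.mk_smul]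
    exact hr i
  obtain ⟨f, hf⟩ := (Submodule.mem_span_range_iff_exists_fun _).1 hmem
  have := Fintype.linearIndependent_iff.1 hli (Fin.cons r (-f)) (by
    simp [Fin.sum_univ_succ, hf]) 0
  simpa using this

instance isLocalHom_algebraMap_nagata (σ : Type*) : IsLocalHom (algebraMap R (Nagata R σ)) := by
  refine ⟨fun r hr => ?_⟩
  by_contra h
  rw [IsScalarTower.algebraMap_apply R (MvPolynomial σ R) (Nagata R σ),
    IsLocalization.AtPrime.isUnit_to_map_iff (Nagata R σ) (extendedMaximalIdeal R σ)] at hr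
  exact hr (Ideal.mem_map_of_mem _ ((IsLocalRing.mem_maximalIdeal r).2 h))

instance isLocalRing_nagata (σ : Type*) : IsLocalRing (Nagata R σ) :=
  IsLocalization.AtPrime.isLocalRing _ (extendedMaximalIdeal R σ)

/-- With θ(v) = 1 the x_j and ∑ v_i y_i form a basis of E''. Flatness descends along the faithfully
flat R → R'', and a finite flat module over a local ring is free. -/
theorem free_of_minorIdeal_eq_top [Module.Finite R E]
    (hy : Submodule.span (Nagata R (Fin k × Fin l)) (Set.range fun i =>
      (Submodule.Quotient.mk (y i) : GenericQuotient R a l)) = ⊤)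
    (hrel : Fintype.linearCombination (Nagata R (Fin k × Fin l)) (fun i =>
      (Submodule.Quotient.mk (y i) : GenericQuotient R a l)) ∘ₗ ψ.mulVecLin = 0)
    (hrank : HasRank R E (l + 1))
    (htop : minorIdeal d ψ = ⊤) : Module.Free R E := by
  obtain ⟨v, hv⟩ := exists_minorMap_eq ψ (x := 1) (htop ▸ Submodule.mem_top)
  have hli := linearIndependent_cons_genericElement a y ψ hy hrel hrank (v := v) (by simp [hv])
  have hfree := Module.Free.of_basis (Module.Basis.mk hli fun u _ => by
    simpa [hv] using minorMap_smul_mem_span a y ψ hy hrel v u)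
  have hff : Module.FaithfullyFlat R (Nagata R (Fin k × Fin l)) :=
    Module.FaithfullyFlat.of_flat_of_isLocalHom
  have := Module.Flat.of_flat_tensorProduct R E (Nagata R (Fin k × Fin l))
  exact Module.free_of_flat_of_isLocalRing

end GenericQuotient

end BourbakiFitting

/-- The generators of `E''` are `x_1, …, x_{e-1}` (the generic elements) followed by
`y_0, …, y_d`, so that there are `n = e + d` of them; `ψ` consists of `d = n - e` columns of the
last `d + 1` rows of the presentation matrix `φ`. -/
theorem theorem5p3 {R : Type*} [CommRing R] [IsNoetherianRing R] [IsLocalRing R]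
    {E : Type*} [AddCommGroup E] [Module R E] [Module.Finite R E]
    (e : ℕ) (he : 2 ≤ e) (hrank : BourbakiFitting.HasRank R E e)
    (U : Submodule R E) (hU : BourbakiFitting.IsReduction U)
    {k : ℕ} (a : Fin k → E) (ha : Submodule.span R (Set.range a) = U)
    {d m : ℕ}
    (y : Fin (d + 1) → BourbakiFitting.Nagata R (Fin k × Fin (e - 1)) ⊗[R] E)
    (φ : Matrix (Fin (e - 1) ⊕ Fin (d + 1)) (Fin m)
      (BourbakiFitting.Nagata R (Fin k × Fin (e - 1))))
    (hφ : BourbakiFitting.IsPresentation φ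
      (Sum.elim (BourbakiFitting.genericElement R a (e - 1)) y))
    (c : Fin d ↪ Fin m)
    (ψ : Matrix (Fin (d + 1)) (Fin d) (BourbakiFitting.Nagata R (Fin k × Fin (e - 1))))
    (hψ : ψ = φ.submatrix Sum.inr c)
    (hgrade : 1 ≤ BourbakiFitting.grade (BourbakiFitting.minorIdeal d ψ)) :
    -- the complex `0 → R''^d → R''^(d+1) → I_d(ψ) → 0`
    (Function.Injective ψ.mulVecLin ∧
      LinearMap.range (BourbakiFitting.minorMap ψ) = BourbakiFitting.minorIdeal d ψ ∧
      BourbakiFitting.minorMap ψ ∘ₗ ψ.mulVecLin = 0) ∧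
    (Module.IsTorsionFree R E → 2 ≤ BourbakiFitting.grade (BourbakiFitting.fittingIdeal R E e) →
      -- a generic Bourbaki ideal exists, and every one is isomorphic to `I_d(ψ)`
      ((∃ I, BourbakiFitting.IsGenericBourbakiIdeal R a e I) ∧
        ∀ I, BourbakiFitting.IsGenericBourbakiIdeal R a e I →
          Nonempty (I ≃ₗ[BourbakiFitting.Nagata R (Fin k × Fin (e - 1))]
            BourbakiFitting.minorIdeal d ψ)) ∧
      (¬ Module.Free R E → 2 ≤ BourbakiFitting.grade (BourbakiFitting.minorIdeal d ψ) →
        -- `I = I_d(ψ)` is a perfect generic Bourbaki ideal, resolved by the complex above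
        BourbakiFitting.IsGenericBourbakiIdeal R a e (BourbakiFitting.minorIdeal d ψ) ∧
        BourbakiFitting.IsPerfectOfGrade (BourbakiFitting.minorIdeal d ψ) 2 ∧
        Function.Exact ψ.mulVecLin (BourbakiFitting.minorMap ψ) ∧
        -- `ψ` presents `I ≅ E'' / F` with respect to the classes of the `y_i`
        ∃ g : BourbakiFitting.GenericQuotient R a (e - 1)
            ≃ₗ[BourbakiFitting.Nagata R (Fin k × Fin (e - 1))] BourbakiFitting.minorIdeal d ψ,
          (∀ i, ((g (Submodule.Quotient.mk (y i)) : BourbakiFitting.minorIdeal d ψ) :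
              BourbakiFitting.Nagata R (Fin k × Fin (e - 1))) =
            BourbakiFitting.signedMinor ψ i) ∧
          BourbakiFitting.IsPresentation ψ fun i => g (Submodule.Quotient.mk (y i)))) := by
  have hn : e - 1 + 1 = e := Nat.sub_add_cancel (by omega)
  have hrank' : BourbakiFitting.HasRank R E (e - 1 + 1) := by rwa [hn]
  obtain ⟨b, hbI, hb⟩ := BourbakiFitting.exists_nonZeroDivisor_of_one_le_grade hgrade
  refine ⟨⟨BourbakiFitting.mulVecLin_injective ψ hbI hb, BourbakiFitting.range_minorMap ψ,
    BourbakiFitting.minorMap_comp_mulVecLin ψ⟩, fun htf hF => ?_⟩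
  have hF' : 2 ≤ BourbakiFitting.grade (BourbakiFitting.fittingIdeal R E (e - 1 + 1)) := by
    rwa [hn]
  obtain ⟨hy, hrel⟩ := BourbakiFitting.relations_genericQuotient a y φ hφ c ψ hψ
  obtain ⟨hli, hfaith⟩ :=
    BourbakiFitting.linearIndependent_genericElement a y ψ hy hrel hrank' hbI hb
  have htors : ∀ s : BourbakiFitting.Nagata R (Fin k × Fin (e - 1)), (∀ x, s * x = 0 → x = 0) →
      ∀ z : BourbakiFitting.GenericQuotient R a (e - 1), s • z = 0 → z = 0 := by
    intro s hs z hz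
    obtain ⟨u, rfl⟩ := Submodule.Quotient.mk_surjective _ z
    rw [← Submodule.Quotient.mk_smul, Submodule.Quotient.mk_eq_zero] at hz
    rw [Submodule.Quotient.mk_eq_zero]
    exact BourbakiFitting.mem_genericSubmodule_of_smul_mem hrank' hU ha hF' hs hz
  have hker := BourbakiFitting.ker_linearCombination_eq ψ _ hrel hbI (htors b hb) hfaith
  obtain ⟨g, hg⟩ := BourbakiFitting.exists_equiv_minorIdeal ψ _ hy hker
  have hgen : BourbakiFitting.IsGenericBourbakiIdeal R a e (BourbakiFitting.minorIdeal d ψ) :=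
    { linearIndependent := hli
      torsionFree := ⟨fun s hs => isSMulRegular_iff_right_eq_zero_of_smul.2
        (htors s fun x hx => hs.1 (hx.trans (mul_zero s).symm))⟩
      rank_one := (BourbakiFitting.hasRank_one_of_mem hbI hb).congr g.symm
      equiv := ⟨g⟩ }
  refine ⟨⟨⟨_, hgen⟩, fun I hI => ?_⟩, fun hfree hgrade₂ => ?_⟩
  · obtain ⟨g'⟩ := hI.equiv
    exact ⟨g'.symm ≪≫ₗ g⟩
  obtain ⟨p, hpI, q, hqI, hpq⟩ := BourbakiFitting.exists_pair_of_two_le_grade hgrade₂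
  have hexact := BourbakiFitting.exact_of_pair ψ hpI hqI hpq
  have htop : BourbakiFitting.minorIdeal d ψ ≠ ⊤ := fun htop =>
    hfree (BourbakiFitting.free_of_minorIdeal_eq_top a y ψ hy hrel hrank' htop)
  refine ⟨hgen, BourbakiFitting.isPerfectOfGrade_two ψ htop hgrade₂, hexact, g, hg, ?_, ?_⟩
  · rw [Set.range_comp' g (fun i => Submodule.Quotient.mk (y i)), ← LinearEquiv.coe_coe,
      ← Submodule.map_span, hy, Submodule.map_top, LinearEquiv.range]
  -- The relations among the images under g are those among the classes of the y_i, namely ker θ,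
  -- which is the image of ψ by exactness.
  · rw [← LinearMap.exact_iff.1 hexact, ← hker]
    ext v
    simp only [LinearMap.mem_ker, Fintype.linearCombination_apply]
    rw [← map_eq_zero_iff g g.injective, map_sum]
    simp only [map_smul]
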